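/- Let $N\ge 1$ and let $\theta_0\in(0,\pi)$. Write $\mathbb S^{N-1}$ for the unit sphere of $\mathbb R^N$, $\mathcal H^{N-1}$ for the Hausdorff measure, $S_{\theta_0}=\{y\in\mathbb S^{N-1}: y\cdot e_N\ge\cos\theta_0\}$, and, for $X\subset\mathbb R^N$ and $x\in\mathbb R^N$, $N_xX=\{\nu\in\mathbb S^{N-1}: (y-x)\cdot\nu\le 0 \text{ for all } y\in X\}$ for the unit normal cone. Consider pairs $(C,\Omega)$, where $C\subset\mathbb R^N$ is a closed convex set with nonempty interior and boundary of class $C^1$, with outer unit normal $\nu_C$, and $\Omega\subset\mathbb R^N\setminus C$ is a nonempty bounded open set. Put $$\Sigma=\overline{\partial\Omega\setminus C},\qquad \mathcal K^+(\Sigma)=\mathcal H^{N-1}\Big(\bigcup_{x\in\Sigma\setminus C}N_x\Sigma\Big).$$ (1) If $$\nu\cdot\nu_C(x)\le\cos\theta_0\quad\text{for all } x\in\Sigma\cap C \text{ and } \nu\in N_x\Sigma, \tag{a}$$ then $$\mathcal K^+(\Sigma)\ge\mathcal H^{N-1}(S_{\theta_0}). \tag{b}$$ (2) For every $r>0$ and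 $\varepsilon>0$ there is $\delta>0$, depending only on $N$, $\theta_0$, $r$ and $\varepsilon$ (not on $C$ or $\Omega$), such that if $\Sigma\cap C\subset B_r(0)$, $$\nu\cdot\nu_C(x)\le\cos\theta_0+\delta\quad\text{for all } x\in\Sigma\cap C \text{ and } \nu\in N_x\Sigma,$$ and $\mathcal K^+(\Sigma)\le\mathcal H^{N-1}(S_{\theta_0})+\delta$, then $\Sigma\cap C$ is nonempty, $\mathrm{width}(\Sigma\cap C)\le\varepsilon$, and, more precisely, there is $x\in\Sigma\cap C$ such that $\Sigma\cap C$ lies between two parallel hyperplanes orthogonal to $\nu_C(x)$ at mutual distance $\varepsilon$. Here $$\mathrm{width}(X)=\inf_{\nu\in\mathbb S^{N-1}}\Big(\sup_{x\in X}x\cdot\nu-\inf_{x\in X}x\cdot\nu\Big).$$ (3) If (a) holds and equality holds in (b), then $\Sigma\cap C$ is nonempty and lies on a support hyperplane of $C$, that is, there are $x\in C$ and $\nu\in N_xC$ such that $(y-x)\cdot\nu=0$ for all $y\in\Sigma\cap C$. -/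

import Mathlib

open MeasureTheory Set

/-- The Euclidean space `ℝ^N` with `N = n + 1`, so that `N - 1 = n`. -/
abbrev EucSp (n : ℕ) : Type := EuclideanSpace ℝ (Fin (n + 1))

/-- The Hausdorff measure `H^{N-1}` on `ℝ^N` (`N = n + 1`) with its usual normalization, i.e. the
gauge is `ω_{N-1} (diam / 2)^{N-1}`, where `ω_k` is the volume of the unit ball of `ℝ^k`.
Mathlib's `μH[d]` uses the gauge `diam ^ d`. -/
noncomputable def hausdorffSurface (n : ℕ) : Measure (EucSp n) :=
  (volume (Metric.ball (0 : EuclideanSpace ℝ (Fin n)) 1) / 2 ^ n) • μH[(n : ℝ)]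

/-- The spherical cap `S_θ = {y ∈ S^{N-1} : y · e_N ≥ cos θ}`. -/
def sphericalCap (n : ℕ) (θ : ℝ) : Set (EucSp n) :=
  {y | ‖y‖ = 1 ∧ Real.cos θ ≤ inner ℝ y (EuclideanSpace.single (Fin.last n) (1 : ℝ))}

/-- The unit normal cone `N_x X`: the unit outward normals of the support hyperplanes of `X`
through `x`. -/
def unitNormalCone {n : ℕ} (X : Set (EucSp n)) (x : EucSp n) : Set (EucSp n) :=
  {ν | ‖ν‖ = 1 ∧ ∀ y ∈ X, inner ℝ (y - x) ν ≤ 0}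

/-- `f` is a `C^1` defining function of `C` on the open neighbourhood `U` of `x`: its gradient does
not vanish on `U`, and `C ∩ U = {f ≤ 0} ∩ U`. -/
structure IsC1DefiningFunction {n : ℕ} (C : Set (EucSp n)) (x : EucSp n) (U : Set (EucSp n))
    (f : EucSp n → ℝ) : Prop where
  isOpen : IsOpen U
  mem : x ∈ U
  contDiffOn : ContDiffOn ℝ 1 f U
  gradient_ne_zero : ∀ y ∈ U, gradient f y ≠ 0
  mem_iff : ∀ y ∈ U, (y ∈ C ↔ f y ≤ 0)

/-- Closed convex sets with nonempty interior and boundary of class `C^1`. -/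
structure IsC1ConvexSet {n : ℕ} (C : Set (EucSp n)) : Prop where
  isClosed : IsClosed C
  convex : Convex ℝ C
  interior_nonempty : (interior C).Nonempty
  exists_definingFunction : ∀ x ∈ frontier C, ∃ U f, IsC1DefiningFunction C x U f

open Classical in
/-- The outer unit normal `ν_C(x)` to a set `C` of class `C^1` at `x ∈ ∂C`: the normalized gradient
of a local defining function (the choice is irrelevant, see `outerUnitNormal_eq`). Only
its values on `∂C` are meaningful. -/
noncomputable def outerUnitNormal {n : ℕ} (C : Set (EucSp n)) (x : EucSp n) : EucSp n :=
  if h : ∃ f : EucSp n → ℝ, ∃ U, IsC1DefiningFunction C x U f then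
    ‖gradient h.choose x‖⁻¹ • gradient h.choose x
  else 0

namespace IsC1DefiningFunction

variable {n : ℕ} {C : Set (EucSp n)} {x : EucSp n} {U V : Set (EucSp n)} {f g : EucSp n → ℝ}

theorem apply_eq_zero (h : IsC1DefiningFunction C x U f) (hx : x ∈ frontier C) : f x = 0 := by
  have hU : U ∈ nhds x := h.isOpen.mem_nhds h.mem
  have hc : ContinuousAt f x := h.contDiffOn.continuousOn.continuousAt hU
  rcases lt_trichotomy (f x) 0 with h0 | h0 | h0
  · exfalso
    apply hx.2
    rw [mem_interior_iff_mem_nhds]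
    filter_upwards [hU, hc.eventually_lt_const h0] with y hy hy'
    exact (h.mem_iff y hy).2 hy'.le
  · exact h0
  · exfalso
    obtain ⟨y, hy, hyC⟩ := mem_closure_iff_nhds.1 hx.1 _
      (Filter.inter_mem hU (hc.eventually_const_lt h0))
    exact absurd ((h.mem_iff y hy.1).1 hyC) (not_le.2 hy.2)

theorem tendsto_slope (h : IsC1DefiningFunction C x U f) (hx : x ∈ frontier C) (v : EucSp n) :
    Filter.Tendsto (fun t : ℝ => t⁻¹ * f (x + t • v)) (nhdsWithin 0 (Ioi 0))
      (nhds (inner ℝ (gradient f x) v)) := by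
  have hU : U ∈ nhds x := h.isOpen.mem_nhds h.mem
  have hd : DifferentiableAt ℝ f x :=
    (h.contDiffOn.differentiableOn one_ne_zero).differentiableAt hU
  have h1 := hd.hasGradientAt.hasFDerivAt.hasLineDerivAt v
  have h2 := (hasDerivAt_iff_tendsto_slope.1 h1).mono_left
    (nhdsWithin_mono (0 : ℝ) (s := Ioi 0) (fun t (ht : 0 < t) => ne_of_gt ht))
  simpa [slope_def_field, h.apply_eq_zero hx, div_eq_inv_mul, slope_fun_def] using h2

/-- The outward direction given by a defining function does not depend on that function. -/
theorem normalized_gradient_eq (hf : IsC1DefiningFunction C x U f)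
    (hg : IsC1DefiningFunction C x V g) (hx : x ∈ frontier C) :
    ‖gradient f x‖⁻¹ • gradient f x = ‖gradient g x‖⁻¹ • gradient g x := by
  have key : ∀ v, inner ℝ (gradient f x) v < 0 → inner ℝ (gradient g x) v ≤ 0 := by
    intro v hv
    refine le_of_tendsto (hg.tendsto_slope hx v) ?_
    have hline : Filter.Tendsto (fun t : ℝ => x + t • v) (nhdsWithin 0 (Ioi 0)) (nhds x) := by
      have : Continuous (fun t : ℝ => x + t • v) := by fun_prop
      simpa using (this.tendsto 0).mono_left nhdsWithin_le_nhds
    filter_upwards [(hf.tendsto_slope hx v).eventually_lt_const hv,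
      hline (hf.isOpen.mem_nhds hf.mem), hline (hg.isOpen.mem_nhds hg.mem),
      self_mem_nhdsWithin] with t ht htU htV ht0
    have ht0' : (0 : ℝ) < t⁻¹ := inv_pos.2 ht0
    have hfneg : f (x + t • v) ≤ 0 := by
      by_contra hcon
      exact absurd ht (not_lt.2 (mul_pos ht0' (not_le.1 hcon)).le)
    have := (hg.mem_iff _ htV).1 ((hf.mem_iff _ htU).2 hfneg)
    exact mul_nonpos_of_nonneg_of_nonpos ht0'.le this
  set a := ‖gradient f x‖⁻¹ • gradient f x with ha
  set b := ‖gradient g x‖⁻¹ • gradient g x with hb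
  have hpf : 0 < ‖gradient f x‖ := norm_pos_iff.2 (hf.gradient_ne_zero x hf.mem)
  have hpg : 0 < ‖gradient g x‖ := norm_pos_iff.2 (hg.gradient_ne_zero x hg.mem)
  have na : ‖a‖ = 1 := by
    rw [ha, norm_smul, norm_inv, norm_norm, inv_mul_cancel₀ hpf.ne']
  have nb : ‖b‖ = 1 := by
    rw [hb, norm_smul, norm_inv, norm_norm, inv_mul_cancel₀ hpg.ne']
  have ea : gradient f x = ‖gradient f x‖ • a := by
    rw [ha, smul_smul, mul_inv_cancel₀ hpf.ne', one_smul]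
  have eb : gradient g x = ‖gradient g x‖ • b := by
    rw [hb, smul_smul, mul_inv_cancel₀ hpg.ne', one_smul]
  by_contra hne
  have hlt : inner ℝ a b < 1 := (inner_lt_one_iff_real_of_norm_eq_one na nb).2 hne
  have h1 : inner ℝ (gradient f x) (b - a) < 0 := by
    rw [ea, real_inner_smul_left, inner_sub_right, real_inner_self_eq_norm_sq, na]
    nlinarith
  have h2 := key _ h1
  rw [eb, real_inner_smul_left, inner_sub_right, real_inner_self_eq_norm_sq, nb,
    real_inner_comm] at h2
  nlinarith

end IsC1DefiningFunction

theorem outerUnitNormal_eq {n : ℕ} {C : Set (EucSp n)} {x : EucSp n} {U : Set (EucSp n)}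
    {f : EucSp n → ℝ} (h : IsC1DefiningFunction C x U f) (hx : x ∈ frontier C) :
    outerUnitNormal C x = ‖gradient f x‖⁻¹ • gradient f x := by
  have hex : ∃ f : EucSp n → ℝ, ∃ U, IsC1DefiningFunction C x U f := ⟨f, U, h⟩
  rw [outerUnitNormal, dif_pos hex]
  obtain ⟨V, hV⟩ := hex.choose_spec
  exact hV.normalized_gradient_eq h hx

/-- `Σ`, the closure of `∂Ω ∖ C`. -/
def freeSurface {n : ℕ} (C Ω : Set (EucSp n)) : Set (EucSp n) :=
  closure (frontier Ω \ C)

/-- The contact part `Σ ∩ C`. -/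
def contactSet {n : ℕ} (C Ω : Set (EucSp n)) : Set (EucSp n) :=
  freeSurface C Ω ∩ C

/-- The total positive curvature `K⁺(Σ)`. -/
noncomputable def totalPositiveCurvature {n : ℕ} (C Ω : Set (EucSp n)) : ENNReal :=
  hausdorffSurface n (⋃ x ∈ freeSurface C Ω \ C, unitNormalCone (freeSurface C Ω) x)

/-- The weak contact angle condition: `ν · ν_C(x) ≤ c` for all `x ∈ Σ ∩ C` and `ν ∈ N_x Σ`. -/
def ContactAngleBound {n : ℕ} (C Ω : Set (EucSp n)) (c : ℝ) : Prop :=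
  ∀ x ∈ contactSet C Ω, ∀ ν ∈ unitNormalCone (freeSurface C Ω) x,
    inner ℝ ν (outerUnitNormal C x) ≤ c

/-- The width of a (nonempty bounded) set: the infimum over unit vectors `ν` of
`sup {x · ν : x ∈ X} - inf {x · ν : x ∈ X}`. -/
noncomputable def setWidth {n : ℕ} (X : Set (EucSp n)) : ℝ :=
  ⨅ ν : Metric.sphere (0 : EucSp n) 1,
    (sSup ((fun x => inner ℝ x (ν : EucSp n)) '' X) -
      sInf ((fun x => inner ℝ x (ν : EucSp n)) '' X))

/-- `X` lies between two parallel hyperplanes orthogonal to `ν` (a unit vector) at mutual distance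
`ε`. -/
def LiesInSlab {n : ℕ} (X : Set (EucSp n)) (ν : EucSp n) (ε : ℝ) : Prop :=
  ∃ t : ℝ, ∀ y ∈ X, t ≤ inner ℝ y ν ∧ inner ℝ y ν ≤ t + ε

/-- `X` lies on a support hyperplane of `C`. -/
def LiesOnSupportHyperplane {n : ℕ} (X C : Set (EucSp n)) : Prop :=
  ∃ x ∈ C, ∃ ν ∈ unitNormalCone C x, ∀ y ∈ X, inner ℝ (y - x) ν = 0

/-- The standing assumptions: `C` is closed, convex, with nonempty interior and of class `C^1`;
`Ω ⊆ ℝ^N ∖ C` is bounded, open and nonempty. -/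
structure IsAdmissiblePair {n : ℕ} (C Ω : Set (EucSp n)) : Prop where
  isC1ConvexSet : IsC1ConvexSet C
  isOpen : IsOpen Ω
  isBounded : Bornology.IsBounded Ω
  nonempty : Ω.Nonempty
  subset_compl : Ω ⊆ Cᶜ

/-! Write W for the contact set Σ ∩ C and u for ν_C on W. For a finite net F of W, the normal cones
of F tile the space up to null sets, and since F ⊆ C the cone at x contains u(x). In each half-plane
bounded by the axis ℝu(x), this cone and the round cone of directions with cosine at least c to u(x)
are both sectors around the ray of u(x), hence nested. Integrating over half-planes gives the
correlation inequality `IsUpCone.volume_mul_le`: the round cone takes at least as large a share of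
the normal cone as of the whole space. Summing over F and refining the net
(`volume_angleCone_finset`, `volume_angleCone_compact`), the normals of W having cosine at least c
with u fill at least the volume of one round cone.

Let c > cos θ₀ and maximize such a direction over Σ. A maximizer in C would also maximize over W,
hence almost surely be the point x itself, against the angle condition. So the direction is a normal
of Σ at a point off C (`volume_angleCone_le`), and c ↓ cos θ₀ gives the lower bound. If W is empty,
all directions are normals off C.

For stability, if W lies in no thin slab orthogonal to a normal u(x), the normal cones of fine nets
miss a fixed neighbourhood of -u(x). Comparing shares inside the remaining round cone, rather than
the whole space, improves the bound by a factor independent of C and Ω, which contradicts near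
equality. The equality case is the limit ε → 0, by compactness.

Measures on the sphere are computed as volumes of cones in the unit ball; by rotation invariance
H^{N-1} is proportional to these. -/

/-! ### Uniqueness of uniformly distributed measures -/

section UniformMeasure

open Filter Topology Metric

/-- Two uniformly distributed measures on `S`: the limit of the ratio of the measures of balls is a
constant `c`, and `c • σ ≤ ρ`. -/
theorem exists_tendsto_ratio_smul_le {E : Type*} [NormedAddCommGroup E] [NormedSpace ℝ E]
    [FiniteDimensional ℝ E] [MeasurableSpace E] [BorelSpace E]
    (ρ σ : Measure E) [IsFiniteMeasure ρ] [IsFiniteMeasure σ]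
    {S : Set E} (hσ : σ Sᶜ = 0) (hσ0 : σ ≠ 0)
    (huρ : ∀ x ∈ S, ∀ y ∈ S, ∀ r, ρ (closedBall x r) = ρ (closedBall y r))
    (huσ : ∀ x ∈ S, ∀ y ∈ S, ∀ r, σ (closedBall x r) = σ (closedBall y r)) :
    ∃ c : ENNReal, c ≠ ⊤ ∧ c • σ ≤ ρ ∧ ∀ x ∈ S,
      Tendsto (fun r => ρ (closedBall x r) / σ (closedBall x r)) (𝓝[>] 0) (𝓝 c) := by
  have hS : ∀ᵐ x ∂σ, x ∈ S := hσ
  have hall : ∀ᵐ x ∂σ, x ∈ S ∧ ρ.rnDeriv σ x < ⊤ ∧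
      Tendsto (fun r => ρ (closedBall x r) / σ (closedBall x r)) (𝓝[>] 0)
        (𝓝 (ρ.rnDeriv σ x)) := by
    filter_upwards [hS, ρ.rnDeriv_lt_top σ, Besicovitch.ae_tendsto_rnDeriv ρ σ] with x h1 h2 h3
    exact ⟨h1, h2, h3⟩
  have : NeBot (ae σ) := ae_neBot.2 hσ0
  obtain ⟨x₀, hx₀, hfin, hlim⟩ := hall.exists
  have hlim' : ∀ x ∈ S, Tendsto (fun r => ρ (closedBall x r) / σ (closedBall x r)) (𝓝[>] 0)
      (𝓝 (ρ.rnDeriv σ x₀)) := fun x hx => by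
    simpa only [huρ x hx x₀ hx₀, huσ x hx x₀ hx₀] using hlim
  refine ⟨ρ.rnDeriv σ x₀, hfin.ne, ?_, hlim'⟩
  -- The ratio does not depend on the centre in `S`, so the density is constant. A singular part of
  -- `ρ` is not excluded here, hence only an inequality.
  have hconst : ρ.rnDeriv σ =ᵐ[σ] fun _ => ρ.rnDeriv σ x₀ := by
    filter_upwards [hall] with x hx
    exact tendsto_nhds_unique hx.2.2 (hlim' x hx.1)
  rw [← withDensity_const, ← withDensity_congr_ae hconst]
  exact Measure.withDensity_rnDeriv_le ρ σ

/-- If one ball centred on `S` were null, all balls of that radius would be, and by compactness so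
would `S`. -/
theorem measure_closedBall_pos_of_uniform {E : Type*} [NormedAddCommGroup E]
    [MeasurableSpace E] (σ : Measure E) {S : Set E} (hS : IsCompact S)
    (hσ : σ Sᶜ = 0) (hσ0 : σ ≠ 0)
    (huσ : ∀ x ∈ S, ∀ y ∈ S, ∀ r, σ (closedBall x r) = σ (closedBall y r))
    {x : E} (hx : x ∈ S) {r : ℝ} (hr : 0 < r) : σ (closedBall x r) ≠ 0 := by
  intro h0
  refine hσ0 (Measure.measure_univ_eq_zero.1 ?_)
  have h1 : σ S = 0 := hS.measure_zero_of_nhdsWithin fun y hy =>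
    ⟨closedBall y r, mem_nhdsWithin_of_mem_nhds (closedBall_mem_nhds y hr), by
      rw [huσ y hy x hx, h0]⟩
  rw [← union_compl_self S]
  exact measure_union_null h1 hσ

/-- Uniformly distributed finite measures on a compact set are proportional. -/
theorem exists_eq_smul_of_uniform {E : Type*} [NormedAddCommGroup E] [NormedSpace ℝ E]
    [FiniteDimensional ℝ E] [MeasurableSpace E] [BorelSpace E]
    (ρ σ : Measure E) [IsFiniteMeasure ρ] [IsFiniteMeasure σ]
    {S : Set E} (hS : IsCompact S) (hρ : ρ Sᶜ = 0) (hσ : σ Sᶜ = 0) (hρ0 : ρ ≠ 0) (hσ0 : σ ≠ 0)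
    (huρ : ∀ x ∈ S, ∀ y ∈ S, ∀ r, ρ (closedBall x r) = ρ (closedBall y r))
    (huσ : ∀ x ∈ S, ∀ y ∈ S, ∀ r, σ (closedBall x r) = σ (closedBall y r)) :
    ∃ κ : ENNReal, κ ≠ 0 ∧ κ ≠ ⊤ ∧ ρ = κ • σ := by
  obtain ⟨c, hc, hcle, hclim⟩ := exists_tendsto_ratio_smul_le ρ σ hσ hσ0 huρ huσ
  obtain ⟨d, hd, hdle, hdlim⟩ := exists_tendsto_ratio_smul_le σ ρ hρ hρ0 huσ huρ
  obtain ⟨x, hx⟩ : S.Nonempty := by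
    rw [nonempty_iff_ne_empty]
    rintro rfl
    exact hσ0 (Measure.measure_univ_eq_zero.1 (by simpa using hσ))
  -- The two constants are limits of reciprocal ratios, so the two one-sided comparisons are inverse
  -- to each other.
  have hdc : d = c⁻¹ := by
    refine tendsto_nhds_unique (hdlim x hx) ?_
    refine ((continuous_inv.tendsto c).comp (hclim x hx)).congr' ?_
    filter_upwards [self_mem_nhdsWithin] with r hr
    exact ENNReal.inv_div (Or.inl (measure_ne_top _ _))
      (Or.inl (measure_closedBall_pos_of_uniform σ hS hσ hσ0 huσ hx hr))
  have hc0 : c ≠ 0 := by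
    rintro rfl
    exact hd (by simpa using hdc)
  refine ⟨c, hc0, hc, le_antisymm ?_ hcle⟩
  have h2 : c • (d • ρ) ≤ c • σ := by gcongr
  rwa [smul_smul, hdc, ENNReal.mul_inv_cancel hc0 hc, one_smul] at h2

end UniformMeasure

/-! ### The cone measure on the sphere and its rotation invariance -/

section SphereMeasure

open Filter Topology Metric

/-- The rotation invariant measure on the unit sphere which gives to `A` the volume of the part of
the cone over `A` in the unit ball. -/
noncomputable def sphereMeasure (n : ℕ) : Measure (EucSp n) :=
  ((volume : Measure (EucSp n)).restrict (ball 0 1)).map (fun v => ‖v‖⁻¹ • v)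

theorem measurable_normalize {n : ℕ} : Measurable (fun v : EucSp n => ‖v‖⁻¹ • v) := by
  fun_prop

theorem sphereMeasure_apply {n : ℕ} {A : Set (EucSp n)} (hA : MeasurableSet A) :
    sphereMeasure n A = volume ((fun v : EucSp n => ‖v‖⁻¹ • v) ⁻¹' A ∩ ball 0 1) := by
  rw [sphereMeasure, Measure.map_apply measurable_normalize hA,
    Measure.restrict_apply (measurable_normalize hA)]

instance (n : ℕ) : IsFiniteMeasure (sphereMeasure n) := by
  have : IsFiniteMeasure ((volume : Measure (EucSp n)).restrict (ball 0 1)) :=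
    ⟨by simpa using measure_ball_lt_top⟩
  unfold sphereMeasure
  infer_instance

theorem sphereMeasure_ne_zero (n : ℕ) : sphereMeasure n ≠ 0 := by
  intro h
  have := sphereMeasure_apply (n := n) MeasurableSet.univ
  rw [h] at this
  simp only [Measure.coe_zero, Pi.zero_apply, preimage_univ, univ_inter] at this
  exact (measure_ball_pos volume (0 : EucSp n) one_pos).ne this

theorem sphereMeasure_compl_sphere (n : ℕ) : sphereMeasure n (sphere 0 1)ᶜ = 0 := by
  rw [sphereMeasure_apply isClosed_sphere.measurableSet.compl]
  -- Only the origin is not normalized to the sphere: it is sent to `0`, as `0⁻¹ = 0`.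
  refine measure_mono_null (t := {0}) ?_ (measure_singleton 0)
  rintro v ⟨hv, -⟩
  by_contra h0
  exact hv (by simp [norm_smul, inv_mul_cancel₀ (norm_ne_zero_iff.2 h0)])

theorem exists_linearIsometryEquiv_apply_eq {n : ℕ} {x y : EucSp n} (h : ‖x‖ = ‖y‖) :
    ∃ T : EucSp n ≃ₗᵢ[ℝ] EucSp n, T x = y :=
  ⟨_, Submodule.reflection_sub h⟩

theorem sphereMeasure_preimage {n : ℕ} (T : EucSp n ≃ₗᵢ[ℝ] EucSp n) {A : Set (EucSp n)}
    (hA : MeasurableSet A) : sphereMeasure n (T ⁻¹' A) = sphereMeasure n A := by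
  rw [sphereMeasure_apply hA, sphereMeasure_apply (T.continuous.measurable hA)]
  rw [← T.measurePreserving.measure_preimage
    ((measurable_normalize hA).inter measurableSet_ball).nullMeasurableSet]
  congr 1
  ext v
  simp

theorem sphereMeasure_closedBall_eq {n : ℕ} {x y : EucSp n} (hx : x ∈ sphere (0 : EucSp n) 1)
    (hy : y ∈ sphere (0 : EucSp n) 1) (r : ℝ) :
    sphereMeasure n (closedBall x r) = sphereMeasure n (closedBall y r) := by
  obtain ⟨T, rfl⟩ := exists_linearIsometryEquiv_apply_eq (x := x) (y := y) (by simp_all)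
  rw [← sphereMeasure_preimage T (A := closedBall (T x) r) measurableSet_closedBall]
  congr 1
  ext v
  simp

end SphereMeasure

/-! ### Hausdorff measure of the sphere: finite, positive, proportional to the cone measure -/

section HausdorffSphere

open Filter Topology Metric

theorem lipschitzOnWith_normalize {E : Type*} [NormedAddCommGroup E] [NormedSpace ℝ E] :
    LipschitzOnWith 2 (fun v : E => ‖v‖⁻¹ • v) {v | 1 ≤ ‖v‖} := by
  refine LipschitzOnWith.of_dist_le_mul fun v (hv : 1 ≤ ‖v‖) w (hw : 1 ≤ ‖w‖) => ?_
  have hv0 : 0 < ‖v‖ := by linarith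
  have hw0 : 0 < ‖w‖ := by linarith
  have e : ‖v‖⁻¹ • v - ‖w‖⁻¹ • w = ‖v‖⁻¹ • (v - w) + (‖v‖⁻¹ * (‖w‖ - ‖v‖)) • (‖w‖⁻¹ • w) := by
    rw [smul_smul, mul_assoc, sub_mul, mul_inv_cancel₀ hw0.ne', mul_sub, ← mul_assoc ‖v‖⁻¹ ‖v‖,
      inv_mul_cancel₀ hv0.ne']
    module
  have h1 : ‖v‖⁻¹ ≤ 1 := inv_le_one_of_one_le₀ hv
  have h2 : |‖w‖ - ‖v‖| ≤ ‖v - w‖ := by rw [norm_sub_rev]; exact abs_norm_sub_norm_le w v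
  rw [dist_eq_norm, dist_eq_norm, e]
  refine (norm_add_le _ _).trans ?_
  rw [norm_smul, norm_smul, norm_smul, norm_inv, norm_inv, norm_norm, norm_norm,
    inv_mul_cancel₀ hw0.ne', mul_one, norm_mul, norm_inv, norm_norm, Real.norm_eq_abs]
  have h3 : 0 ≤ ‖v‖⁻¹ := by positivity
  have h4 := norm_nonneg (v - w)
  have h5 := abs_nonneg (‖w‖ - ‖v‖)
  simp only [NNReal.coe_ofNat]
  nlinarith [mul_le_mul h1 h2 h5 zero_le_one, mul_le_mul h1 le_rfl h4 zero_le_one]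

/-- The affine parametrization of the hyperplane `x i = s` in `ℝ^(n + 1)`. -/
noncomputable def insertCoord (n : ℕ) (i : Fin (n + 1)) (s : ℝ) (z : Fin n → ℝ) : EucSp n :=
  WithLp.toLp 2 (i.insertNth s z : Fin (n + 1) → ℝ)

theorem exists_lipschitzWith_insertCoord (n : ℕ) (i : Fin (n + 1)) (s : ℝ) :
    ∃ K, LipschitzWith K (insertCoord n i s) := by
  have h1 : LipschitzWith 1 (fun z : Fin n → ℝ => (i.insertNth s z : Fin (n + 1) → ℝ)) := by
    refine LipschitzWith.of_dist_le_mul fun z w => ?_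
    rw [NNReal.coe_one, one_mul, dist_pi_le_iff dist_nonneg]
    rw [Fin.forall_iff_succAbove i]
    simp only [Fin.insertNth_apply_same, dist_self, dist_nonneg, Fin.insertNth_apply_succAbove,
      true_and]
    exact fun j => dist_le_pi_dist z w j
  exact ⟨_, (PiLp.lipschitzWith_toLp 2 (fun _ : Fin (n + 1) => ℝ)).comp h1⟩

theorem one_le_norm_insertCoord {n : ℕ} {i : Fin (n + 1)} {s : ℝ} (hs : |s| = 1)
    (z : Fin n → ℝ) : 1 ≤ ‖insertCoord n i s z‖ := by
  have := PiLp.norm_apply_le (insertCoord n i s z) i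
  simpa [insertCoord, hs] using this

/-- Dividing by the largest absolute value of a coordinate puts the point on a face of the cube. The
sphere is thus covered by finitely many Lipschitz images of an `n`-dimensional cube, which makes its
measure finite. -/
theorem sphere_subset_iUnion_normalize (n : ℕ) :
    sphere (0 : EucSp n) 1 ⊆ ⋃ i : Fin (n + 1), ⋃ s ∈ ({1, -1} : Set ℝ),
      ((fun v : EucSp n => ‖v‖⁻¹ • v) ∘ insertCoord n i s) '' Icc (-1) 1 := by
  intro y hy
  have hy1 : ‖y‖ = 1 := by simpa using hy
  obtain ⟨i, -, hi⟩ := Finset.exists_max_image Finset.univ (fun i => |y i|) ⟨0, Finset.mem_univ _⟩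
  have hpos : 0 < |y i| := by
    rw [abs_pos]
    intro h0
    have : y = 0 := by
      ext j
      have := hi j (Finset.mem_univ _)
      rw [h0, abs_zero] at this
      simpa using this
    simp [this] at hy1
  refine mem_iUnion.2 ⟨i, mem_iUnion₂.2 ⟨y i / |y i|, ?_, fun j => y (i.succAbove j) / |y i|, ?_,
    ?_⟩⟩
  · rcases abs_cases (y i) with ⟨h, -⟩ | ⟨h, -⟩
    · left
      rw [h, div_self]
      rw [← h]; exact hpos.ne'
    · right
      rw [mem_singleton_iff, h, div_neg, div_self]
      exact abs_pos.1 hpos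
  · have h (j : Fin n) : |y (i.succAbove j) / abs (y i)| ≤ 1 := by
      rw [abs_div, abs_abs]
      exact (div_le_one hpos).2 (hi _ (Finset.mem_univ _))
    exact ⟨fun j => (abs_le.1 (h j)).1, fun j => (abs_le.1 (h j)).2⟩
  · have e : insertCoord n i (y i / |y i|) (fun j => y (i.succAbove j) / |y i|) =
        |y i|⁻¹ • y := by
      ext k
      refine Fin.succAboveCases i ?_ ?_ k
      · simp [insertCoord, div_eq_inv_mul]
      · intro j
        simp [insertCoord, div_eq_inv_mul]
    simp only [Function.comp_apply, e]
    rw [norm_smul, hy1, smul_smul]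
    simp [hpos.ne']

theorem hausdorffMeasure_sphere_lt_top (n : ℕ) :
    μH[(n : ℝ)] (sphere (0 : EucSp n) 1) < ⊤ := by
  refine (measure_mono (sphere_subset_iUnion_normalize n)).trans_lt ?_
  refine (measure_iUnion_le _).trans_lt ?_
  rw [tsum_fintype]
  refine ENNReal.sum_lt_top.2 fun i _ => ?_
  refine measure_biUnion_lt_top (by simp) fun s hs => ?_
  have hs1 : |s| = 1 := by rcases hs with rfl | rfl <;> simp
  obtain ⟨K, hK⟩ := exists_lipschitzWith_insertCoord n i s
  have hL := (lipschitzOnWith_normalize (E := EucSp n)).comp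
    (hK.lipschitzOnWith (s := Icc (-1) 1)) (fun z _ => one_le_norm_insertCoord hs1 z)
  refine (hL.hausdorffMeasure_image_le (Nat.cast_nonneg n)).trans_lt ?_
  refine ENNReal.mul_lt_top (ENNReal.rpow_lt_top_of_nonneg (Nat.cast_nonneg n)
    ENNReal.coe_ne_top) ?_
  have h := hausdorffMeasure_pi_real (ι := Fin n)
  rw [Fintype.card_fin] at h
  rw [h]
  exact isCompact_Icc.measure_lt_top

/-- Forgetting the last coordinate is 1-Lipschitz and maps the sphere onto a set containing a ball
of `ℝ^n`. -/
theorem hausdorffMeasure_sphere_pos (n : ℕ) :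
    0 < μH[(n : ℝ)] (sphere (0 : EucSp n) 1) := by
  set p : EucSp n → (Fin n → ℝ) := fun y j => y j.castSucc with hp
  have hL : LipschitzWith 1 p := by
    refine LipschitzWith.of_dist_le_mul fun y w => ?_
    rw [NNReal.coe_one, one_mul, dist_pi_le_iff dist_nonneg]
    intro j
    have := PiLp.norm_apply_le (y - w) j.castSucc
    simpa [hp, dist_eq_norm] using this
  have h1 := hL.hausdorffMeasure_image_le (d := (n : ℝ)) (Nat.cast_nonneg n)
    (sphere (0 : EucSp n) 1)
  simp only [ENNReal.coe_one, ENNReal.one_rpow, one_mul] at h1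
  refine lt_of_lt_of_le ?_ h1
  have h := hausdorffMeasure_pi_real (ι := Fin n)
  rw [Fintype.card_fin] at h
  rw [h]
  -- With this sup-norm radius the sum of the `n` squares is at most `n / (n + 1) ≤ 1`, so a last
  -- coordinate completing `z` to a unit vector exists.
  have hr : (0 : ℝ) < 1 / (n + 1) := by positivity
  refine (measure_ball_pos volume (0 : Fin n → ℝ) hr).trans_le (measure_mono fun z hz => ?_)
  have hz' : ∀ j, |z j| ≤ 1 / (n + 1) := fun j =>
    (norm_le_pi_norm z j).trans (by simpa using (mem_ball.1 hz).le)
  have hsum : ∑ j, z j ^ 2 ≤ 1 := by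
    have h2 : ∀ j ∈ Finset.univ, z j ^ 2 ≤ 1 / ((n : ℝ) + 1) := fun j _ => by
      have h3 : 1 / ((n : ℝ) + 1) ≤ 1 := by
        rw [div_le_one (by positivity)]
        linarith [(Nat.cast_nonneg n : (0 : ℝ) ≤ n)]
      rw [← sq_abs]
      nlinarith [hz' j, abs_nonneg (z j)]
    refine (Finset.sum_le_card_nsmul _ _ _ h2).trans ?_
    rw [Finset.card_univ, Fintype.card_fin, nsmul_eq_mul, mul_one_div, div_le_one (by positivity)]
    linarith
  refine ⟨WithLp.toLp 2 (Fin.snoc (α := fun _ => ℝ) z (√(1 - ∑ j, z j ^ 2))), ?_, ?_⟩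
  · rw [mem_sphere_zero_iff_norm, ← sq_eq_sq₀ (norm_nonneg _) zero_le_one,
      EuclideanSpace.norm_sq_eq, Fin.sum_univ_castSucc]
    simp [Real.sq_sqrt (sub_nonneg.2 hsum)]
  · ext j
    simp [hp]

theorem hausdorffSurface_const_ne_zero (n : ℕ) :
    volume (Metric.ball (0 : EuclideanSpace ℝ (Fin n)) 1) / 2 ^ n ≠ 0 :=
  (ENNReal.div_pos (measure_ball_pos _ _ one_pos).ne' (by simp)).ne'

theorem hausdorffSurface_const_ne_top (n : ℕ) :
    volume (Metric.ball (0 : EuclideanSpace ℝ (Fin n)) 1) / 2 ^ n ≠ ⊤ :=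
  ENNReal.div_ne_top measure_ball_lt_top.ne (by simp)

/-- On the unit sphere, the Hausdorff measure is a multiple of the cone measure. -/
theorem exists_hausdorffSurface_eq_smul (n : ℕ) : ∃ κ : ENNReal, κ ≠ 0 ∧ κ ≠ ⊤ ∧
    ∀ A ⊆ sphere (0 : EucSp n) 1, hausdorffSurface n A = κ * sphereMeasure n A := by
  set ρ : Measure (EucSp n) := (hausdorffSurface n).restrict (sphere 0 1) with hρ
  have hS : MeasurableSet (sphere (0 : EucSp n) 1) := isClosed_sphere.measurableSet
  have hval : hausdorffSurface n (sphere (0 : EucSp n) 1) ≠ ⊤ := by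
    simp only [hausdorffSurface, Measure.smul_apply, smul_eq_mul]
    exact ENNReal.mul_ne_top (hausdorffSurface_const_ne_top n)
      (hausdorffMeasure_sphere_lt_top n).ne
  have hval0 : hausdorffSurface n (sphere (0 : EucSp n) 1) ≠ 0 := by
    simp only [hausdorffSurface, Measure.smul_apply, smul_eq_mul]
    exact mul_ne_zero (hausdorffSurface_const_ne_zero n) (hausdorffMeasure_sphere_pos n).ne'
  have : IsFiniteMeasure ρ := ⟨by simpa [hρ] using hval.lt_top⟩
  have hinv : ∀ (T : EucSp n ≃ₗᵢ[ℝ] EucSp n) (A : Set (EucSp n)), MeasurableSet A →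
      ρ (T ⁻¹' A) = ρ A := by
    intro T A hA
    have e : T ⁻¹' A ∩ sphere 0 1 = T.toIsometryEquiv ⁻¹' (A ∩ sphere 0 1) := by
      ext v; simp
    rw [hρ, Measure.restrict_apply hA, Measure.restrict_apply (T.continuous.measurable hA), e]
    simp only [hausdorffSurface, Measure.smul_apply, smul_eq_mul]
    rw [IsometryEquiv.hausdorffMeasure_preimage]
  obtain ⟨κ, h0, htop, h⟩ := exists_eq_smul_of_uniform ρ (sphereMeasure n)
    (isCompact_sphere (0 : EucSp n) 1) (by simp [hρ, Measure.restrict_apply hS.compl])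
    (sphereMeasure_compl_sphere n)
    (by rw [hρ, ne_eq, Measure.restrict_eq_zero]; exact hval0) (sphereMeasure_ne_zero n)
    (fun x hx y hy r => by
      obtain ⟨T, rfl⟩ := exists_linearIsometryEquiv_apply_eq (x := x) (y := y) (by simp_all)
      rw [← hinv T (closedBall (T x) r) measurableSet_closedBall]
      congr 1
      ext v
      simp)
    (fun x hx y hy r => sphereMeasure_closedBall_eq hx hy r)
  -- Restricting to the measurable sphere requires no measurability of `A`; the sets of normals need
  -- not be shown measurable.
  refine ⟨κ, h0, htop, fun A hA => ?_⟩
  have := congrArg (fun m => m A) h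
  simpa [hρ, Measure.restrict_apply' hS, inter_eq_left.2 hA] using this

end HausdorffSphere

/-! ### The correlation inequality for cones around an axis -/

section UpCone

open Filter Topology Metric

theorem measurePreserving_smul_sphere {F : Type*} [NormedAddCommGroup F] [NormedSpace ℝ F]
    [FiniteDimensional ℝ F] [MeasurableSpace F] [BorelSpace F] [Nontrivial F] (μ : Measure F)
    [μ.IsAddHaarMeasure] :
    MeasurePreserving (fun p : sphere (0 : F) 1 × Ioi (0 : ℝ) => p.2.1 • p.1.1)
      (μ.toSphere.prod (Measure.volumeIoiPow (Module.finrank ℝ F - 1))) μ := by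
  have h1 := MeasurePreserving.symm (homeomorphUnitSphereProd F).toMeasurableEquiv
    μ.measurePreserving_homeomorphUnitSphereProd
  have h2 := (measurePreserving_subtype_coe (μa := μ)
    (measurableSet_singleton (0 : F)).compl).comp h1
  have h3 : ∀ᵐ x ∂μ, x ∈ ({0}ᶜ : Set F) := compl_mem_ae_iff.2 (measure_singleton 0)
  rw [Measure.restrict_eq_self_of_ae_mem h3] at h2
  exact h2

/-- Polar coordinates in the second factor of a product. -/
theorem prod_apply_polar {F : Type*} [NormedAddCommGroup F] [NormedSpace ℝ F]
    [FiniteDimensional ℝ F] [MeasurableSpace F] [BorelSpace F] [Nontrivial F] (μ : Measure F)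
    [μ.IsAddHaarMeasure] (ν : Measure ℝ) [SFinite ν] {Y : Set (ℝ × F)} (hY : MeasurableSet Y) :
    Measurable (fun ω : sphere (0 : F) 1 =>
      (ν.prod (Measure.volumeIoiPow (Module.finrank ℝ F - 1)))
        {p : ℝ × Ioi (0 : ℝ) | (p.1, p.2.1 • ω.1) ∈ Y}) ∧
    (ν.prod μ) Y = ∫⁻ ω : sphere (0 : F) 1,
      (ν.prod (Measure.volumeIoiPow (Module.finrank ℝ F - 1)))
        {p : ℝ × Ioi (0 : ℝ) | (p.1, p.2.1 • ω.1) ∈ Y} ∂μ.toSphere := by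
  set m := Measure.volumeIoiPow (Module.finrank ℝ F - 1)
  have h1 : MeasurePreserving (Prod.map id (fun p : sphere (0 : F) 1 × Ioi (0 : ℝ) =>
      p.2.1 • p.1.1)) (ν.prod (μ.toSphere.prod m)) (ν.prod μ) :=
    (MeasurePreserving.id ν).prod (measurePreserving_smul_sphere μ)
  -- The factors are reordered so that the sphere comes first and becomes the outer variable of
  -- integration.
  have h2 := (measurePreserving_prodAssoc μ.toSphere ν m).symm
  have h3 := ((Measure.measurePreserving_swap (μ := μ.toSphere) (ν := ν)).prod
    (MeasurePreserving.id m)).comp h2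
  have h4 := h1.comp ((measurePreserving_prodAssoc ν μ.toSphere m).comp h3)
  have hm := h4.measurable hY
  refine ⟨measurable_measure_prodMk_left hm, ?_⟩
  rw [← h4.measure_preimage hY.nullMeasurableSet, Measure.prod_apply hm]
  rfl

/-- The linear isomorphism `(a, w) ↦ a u + w` from `ℝ × u^⊥`. -/
noncomputable def axisEquiv {n : ℕ} (u : EucSp n) (hu : ‖u‖ = 1) :
    (ℝ × (ℝ ∙ u)ᗮ) ≃L[ℝ] EucSp n :=
  LinearEquiv.toContinuousLinearEquiv
    { toFun := fun p => p.1 • u + p.2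
      invFun := fun v => (inner ℝ u v, ⟨v - inner ℝ u v • u, by
        rw [Submodule.mem_orthogonal_singleton_iff_inner_right, inner_sub_right,
          real_inner_smul_right, real_inner_self_eq_norm_sq, hu]
        ring⟩)
      map_add' := fun p q => by
        simp only [Prod.fst_add, Prod.snd_add, Submodule.coe_add]
        module
      map_smul' := fun c p => by
        simp only [Prod.smul_fst, Prod.smul_snd, Submodule.coe_smul, smul_eq_mul,
          RingHom.id_apply]
        module
      left_inv := fun p => by
        have h := (Submodule.mem_orthogonal_singleton_iff_inner_right).1 p.2.2
        have e : inner ℝ u (p.1 • u + (p.2 : EucSp n)) = p.1 := by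
          rw [inner_add_right, h, real_inner_smul_right, real_inner_self_eq_norm_sq, hu]
          ring
        ext1
        · exact e
        · ext1
          simp only [e]
          module
      right_inv := fun v => by
        simp }

/-- Uniqueness of Haar measure. The value of `κ` is irrelevant, since both sides of the correlation
inequality are products of two volumes. -/
theorem exists_volume_eq_axisEquiv {n : ℕ} (u : EucSp n) (hu : ‖u‖ = 1) : ∃ κ : ENNReal,
    ∀ X : Set (EucSp n), MeasurableSet X → volume X =
      κ * ((volume : Measure ℝ).prod (volume : Measure (ℝ ∙ u)ᗮ)) (axisEquiv u hu ⁻¹' X) := by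
  have := (axisEquiv u hu).isAddHaarMeasure_map
    ((volume : Measure ℝ).prod (volume : Measure (ℝ ∙ u)ᗮ))
  obtain ⟨κ, h⟩ : ∃ κ : NNReal, volume = κ • Measure.map (axisEquiv u hu)
      ((volume : Measure ℝ).prod (volume : Measure (ℝ ∙ u)ᗮ)) :=
    ⟨_, Measure.isAddLeftInvariant_eq_smul _ _⟩
  refine ⟨κ, fun X hX => ?_⟩
  conv_lhs => rw [h]
  rw [Measure.smul_apply, ENNReal.smul_def, smul_eq_mul, Measure.map_apply (axisEquiv u hu).continuous.measurable hX]

/-- Cones which are star-shaped around the direction `u`. -/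
def IsUpCone {n : ℕ} (u : EucSp n) (K : Set (EucSp n)) : Prop :=
  ∀ v ∈ K, ∀ s t : ℝ, 0 < s → 0 ≤ t → s • v + t • u ∈ K

/-- Sets which are rotationally symmetric around the axis `u`. -/
def IsAxisymmetric {n : ℕ} (u : EucSp n) (K : Set (EucSp n)) : Prop :=
  ∀ v ∈ K, ∀ w, inner ℝ v u = inner ℝ w u → ‖v‖ = ‖w‖ → w ∈ K

/-- In a half-plane bounded by the axis, two up-cones are nested. -/
theorem IsUpCone.nested {n : ℕ} {u : EucSp n} {K L : Set (EucSp n)} (hK : IsUpCone u K)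
    (hL : IsUpCone u L) (w : EucSp n) :
    (∀ a s : ℝ, 0 < s → a • u + s • w ∈ K → a • u + s • w ∈ L) ∨
      (∀ a s : ℝ, 0 < s → a • u + s • w ∈ L → a • u + s • w ∈ K) := by
  by_contra! hcon
  obtain ⟨⟨a, s, hs, h1, h2⟩, b, r, hr, h3, h4⟩ := hcon
  -- Membership of `a • u + s • w` is monotone in the slope `a / s`: rescale by `r / s`, then add a
  -- nonnegative multiple of `u`.
  have key : ∀ {M : Set (EucSp n)}, IsUpCone u M → ∀ {a s b r : ℝ}, 0 < s → 0 < r →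
      a / s ≤ b / r → a • u + s • w ∈ M → b • u + r • w ∈ M := by
    intro M hM a s b r hs hr hab h
    have h5 := hM _ h (r / s) (b - r / s * a) (by positivity) (by
      rw [div_le_div_iff₀ hs hr] at hab
      rw [sub_nonneg, div_mul_eq_mul_div, div_le_iff₀ hs]
      linarith)
    convert h5 using 1
    have : r = r / s * s := by field_simp
    rw [smul_add, smul_smul, smul_smul, ← this]
    module
  rcases le_total (a / s) (b / r) with h | h
  · exact h4 (key hK hs hr h h1)
  · exact h2 (key hL hr hs h h3)

theorem measure_mul_le_of_nested {α : Type*} [MeasurableSpace α] (μ : Measure α) {K L B : Set α}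
    (h : K ⊆ L ∨ L ⊆ K) (hKB : K ⊆ B) (hLB : L ⊆ B) : μ K * μ L ≤ μ (K ∩ L) * μ B := by
  rcases h with h | h
  · rw [inter_eq_left.2 h]
    gcongr
  · rw [inter_eq_right.2 h, mul_comm]
    gcongr

/-- Correlation inequality for an up-cone `K` and an axisymmetric up-cone `L`. -/
theorem IsUpCone.volume_mul_le {n : ℕ} {u : EucSp n} (hu : ‖u‖ = 1) {K L B : Set (EucSp n)}
    (hK : IsUpCone u K) (hL : IsUpCone u L) (hKm : MeasurableSet K) (hLm : MeasurableSet L)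
    (hBm : MeasurableSet B) (hLs : IsAxisymmetric u L) (hBs : IsAxisymmetric u B)
    (hKB : K ⊆ B) (hLB : L ⊆ B) :
    volume (K ∩ ball 0 1) * volume (L ∩ ball 0 1) ≤
      volume (K ∩ L ∩ ball 0 1) * volume (B ∩ ball 0 1) := by
  have hdec : ∀ v : EucSp n, ∃ w : (ℝ ∙ u)ᗮ, v = inner ℝ u v • u + w := fun v =>
    ⟨_, ((axisEquiv u hu).apply_symm_apply v).symm⟩
  -- In dimension one there are no directions orthogonal to `u`, and the cones are nested on the
  -- axis itself.
  rcases subsingleton_or_nontrivial (ℝ ∙ u)ᗮ with hF | hF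
  · have hsplit : ∀ v : EucSp n, v = inner ℝ u v • u + (1 : ℝ) • (0 : EucSp n) := fun v => by
      obtain ⟨w, hw⟩ := hdec v
      rw [Subsingleton.elim w 0] at hw
      simpa using hw
    have hn : K ⊆ L ∨ L ⊆ K := by
      refine (hK.nested hL 0).imp (fun h v hv => ?_) (fun h v hv => ?_) <;>
      · rw [hsplit v] at hv ⊢
        exact h _ _ one_pos hv
    rw [inter_inter_distrib_right]
    exact measure_mul_le_of_nested _ (hn.imp (fun h => inter_subset_inter_left _ h)
      (fun h => inter_subset_inter_left _ h)) (inter_subset_inter_left _ hKB)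
      (inter_subset_inter_left _ hLB)
  · obtain ⟨κ, hκ⟩ := exists_volume_eq_axisEquiv u hu
    set m := (volume : Measure ℝ).prod
      (Measure.volumeIoiPow (Module.finrank ℝ (ℝ ∙ u)ᗮ - 1)) with hm
    -- The trace on the open half-plane bounded by `ℝu` and containing `ω`, in the coordinates
    -- (height, distance to the axis).
    set slice : Set (EucSp n) → sphere (0 : (ℝ ∙ u)ᗮ) 1 → Set (ℝ × Ioi (0 : ℝ)) :=
      fun X ω => {p | p.1 • u + p.2.1 • (ω.1 : EucSp n) ∈ X ∩ ball 0 1} with hslice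
    have hvol : ∀ X : Set (EucSp n), MeasurableSet X → Measurable (fun ω => m (slice X ω)) ∧
        volume (X ∩ ball 0 1) =
          κ * ∫⁻ ω, m (slice X ω) ∂(volume : Measure (ℝ ∙ u)ᗮ).toSphere := by
      intro X hX
      have hX' := hX.inter (measurableSet_ball (x := (0 : EucSp n)) (ε := 1))
      have := prod_apply_polar (volume : Measure (ℝ ∙ u)ᗮ) (volume : Measure ℝ)
        ((axisEquiv u hu).continuous.measurable hX')
      rw [hκ _ hX']
      exact ⟨this.1, by rw [this.2]; rfl⟩
    obtain ⟨ω₀⟩ : Nonempty (sphere (0 : (ℝ ∙ u)ᗮ) 1) :=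
      (NormedSpace.sphere_nonempty.2 zero_le_one).to_subtype
    have hinner : ∀ (ω : sphere (0 : (ℝ ∙ u)ᗮ) 1) (p : ℝ × Ioi (0 : ℝ)),
        inner ℝ (p.1 • u + p.2.1 • (ω.1 : EucSp n)) u = p.1 ∧
        ‖p.1 • u + p.2.1 • (ω.1 : EucSp n)‖ ^ 2 = p.1 ^ 2 + p.2.1 ^ 2 := by
      intro ω p
      have h0 : inner ℝ (ω.1 : EucSp n) u = 0 :=
        (Submodule.mem_orthogonal_singleton_iff_inner_left).1 ω.1.2
      have h1 : ‖(ω.1 : EucSp n)‖ = 1 := by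
        have := ω.2
        rwa [mem_sphere_zero_iff_norm] at this
      constructor
      · rw [inner_add_left, real_inner_smul_left, real_inner_smul_left, h0,
          real_inner_self_eq_norm_sq, hu]
        ring
      · rw [norm_add_sq_real, real_inner_smul_left, real_inner_smul_right, real_inner_comm, h0,
          norm_smul, norm_smul, hu, h1, mul_one, mul_one, Real.norm_eq_abs, Real.norm_eq_abs,
          sq_abs, sq_abs]
        ring
    have hsym : ∀ X : Set (EucSp n), IsAxisymmetric u X → ∀ ω, slice X ω = slice X ω₀ := by
      have key : ∀ X : Set (EucSp n), IsAxisymmetric u X → ∀ ω ω', slice X ω ⊆ slice X ω' := by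
        intro X hX ω ω' p hp
        have hnorm : ‖p.1 • u + p.2.1 • (ω.1 : EucSp n)‖ = ‖p.1 • u + p.2.1 • (ω'.1 : EucSp n)‖ :=
          by rw [← sq_eq_sq₀ (norm_nonneg _) (norm_nonneg _), (hinner ω p).2, (hinner ω' p).2]
        refine ⟨hX _ hp.1 _ ?_ hnorm, ?_⟩
        · rw [(hinner ω p).1, (hinner ω' p).1]
        · have := hp.2
          rwa [mem_ball_zero_iff, hnorm, ← mem_ball_zero_iff] at this
      exact fun X hX ω => (key X hX _ _).antisymm (key X hX _ _)
    have hpt : ∀ ω, m (slice K ω) * m (slice L ω₀) ≤ m (slice (K ∩ L) ω) * m (slice B ω₀) := by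
      intro ω
      rw [← hsym L hLs ω, ← hsym B hBs ω]
      have e : slice (K ∩ L) ω = slice K ω ∩ slice L ω := by
        ext p
        simp only [hslice, mem_ofPred_eq, mem_inter_iff]
        tauto
      rw [e]
      refine measure_mul_le_of_nested m ?_ (fun p hp => ⟨hKB hp.1, hp.2⟩)
        (fun p hp => ⟨hLB hp.1, hp.2⟩)
      exact (hK.nested hL (ω.1 : EucSp n)).imp (fun h p hp => ⟨h _ _ p.2.2 hp.1, hp.2⟩)
        (fun h p hp => ⟨h _ _ p.2.2 hp.1, hp.2⟩)
    -- By symmetry the slices of `L` and `B` are the same for all `ω`, so their measures are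
    -- constants that leave the integrals.
    have hint : (∫⁻ ω, m (slice K ω) ∂(volume : Measure (ℝ ∙ u)ᗮ).toSphere) * m (slice L ω₀) ≤
        (∫⁻ ω, m (slice (K ∩ L) ω) ∂(volume : Measure (ℝ ∙ u)ᗮ).toSphere) * m (slice B ω₀) := by
      rw [← lintegral_mul_const _ (hvol K hKm).1, ← lintegral_mul_const _ (hvol _ (hKm.inter hLm)).1]
      exact lintegral_mono hpt
    have hconst : ∀ X : Set (EucSp n), IsAxisymmetric u X →
        ∫⁻ ω, m (slice X ω) ∂(volume : Measure (ℝ ∙ u)ᗮ).toSphere =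
          m (slice X ω₀) * (volume : Measure (ℝ ∙ u)ᗮ).toSphere univ := by
      intro X hX
      rw [← lintegral_const]
      exact lintegral_congr fun ω => by rw [hsym X hX ω]
    rw [(hvol K hKm).2, (hvol L hLm).2, (hvol B hBm).2, (hvol _ (hKm.inter hLm)).2,
      hconst L hLs, hconst B hBs]
    calc _ = κ * κ * (volume : Measure (ℝ ∙ u)ᗮ).toSphere univ *
          ((∫⁻ ω, m (slice K ω) ∂(volume : Measure (ℝ ∙ u)ᗮ).toSphere) * m (slice L ω₀)) := by ring
      _ ≤ κ * κ * (volume : Measure (ℝ ∙ u)ᗮ).toSphere univ *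
          ((∫⁻ ω, m (slice (K ∩ L) ω) ∂(volume : Measure (ℝ ∙ u)ᗮ).toSphere) *
            m (slice B ω₀)) := by gcongr
      _ = _ := by ring

end UpCone

/-! ### Normal cones of finite and compact sets -/

section Cones

open Filter Topology Metric

variable {n : ℕ}

/-- The cone of vectors `v` making with `u` an angle of cosine at least `c`. -/
def capCone (u : EucSp n) (c : ℝ) : Set (EucSp n) := {v | c * ‖v‖ ≤ inner ℝ v u}

/-- The normal cone of `W` at `x`. -/
def dualCone (W : Set (EucSp n)) (x : EucSp n) : Set (EucSp n) :=
  {v | ∀ y ∈ W, inner ℝ (y - x) v ≤ 0}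

/-- The normals of `W` whose angle with the reference direction `u x` at the contact point has
cosine at least `c`. -/
def angleCone (W : Set (EucSp n)) (u : EucSp n → EucSp n) (c : ℝ) : Set (EucSp n) :=
  ⋃ x ∈ W, dualCone W x ∩ capCone (u x) c

theorem isClosed_capCone (u : EucSp n) (c : ℝ) : IsClosed (capCone u c) :=
  isClosed_le (by fun_prop) (by fun_prop)

theorem isClosed_dualCone (W : Set (EucSp n)) (x : EucSp n) : IsClosed (dualCone W x) := by
  have : dualCone W x = ⋂ y ∈ W, {v | inner ℝ (y - x) v ≤ 0} := by
    ext v; simp [dualCone]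
  rw [this]
  exact isClosed_biInter fun y _ => isClosed_le (by fun_prop) (by fun_prop)

theorem capCone_anti (u : EucSp n) {b c : ℝ} (h : b ≤ c) : capCone u c ⊆ capCone u b :=
  fun v (hv : c * ‖v‖ ≤ _) => (mul_le_mul_of_nonneg_right h (norm_nonneg v)).trans hv

theorem capCone_neg_one {u : EucSp n} (hu : ‖u‖ = 1) : capCone u (-1) = univ := by
  refine eq_univ_of_forall fun v => ?_
  have := (abs_le.1 (abs_real_inner_le_norm v u)).1
  rw [hu, mul_one] at this
  simpa [capCone] using this

theorem isUpCone_capCone {u : EucSp n} (hu : ‖u‖ = 1) {c : ℝ} (hc : |c| ≤ 1) :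
    IsUpCone u (capCone u c) := by
  intro v (hv : c * ‖v‖ ≤ _) s t hs ht
  change c * ‖s • v + t • u‖ ≤ inner ℝ (s • v + t • u) u
  rw [inner_add_left, real_inner_smul_left, real_inner_smul_left, real_inner_self_eq_norm_sq, hu]
  have h1 : |‖s • v + t • u‖ - ‖s • v‖| ≤ t := by
    have := abs_norm_sub_norm_le (s • v + t • u) (s • v)
    rwa [add_sub_cancel_left, norm_smul t, hu, mul_one, Real.norm_eq_abs t, abs_of_nonneg ht] at this
  have h2 : c * (‖s • v + t • u‖ - ‖s • v‖) ≤ t := by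
    refine (le_abs_self _).trans ?_
    rw [abs_mul]
    nlinarith [abs_nonneg (‖s • v + t • u‖ - ‖s • v‖)]
  rw [norm_smul, Real.norm_eq_abs, abs_of_pos hs] at h2
  nlinarith

theorem isAxisymmetric_capCone (u : EucSp n) (c : ℝ) : IsAxisymmetric u (capCone u c) := by
  intro v (hv : c * ‖v‖ ≤ _) w h1 h2
  change c * ‖w‖ ≤ _
  rwa [← h1, ← h2]

theorem isUpCone_dualCone {W : Set (EucSp n)} {x u : EucSp n} (hu : u ∈ dualCone W x) :
    IsUpCone u (dualCone W x) := by
  intro v hv s t hs ht y hy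
  rw [inner_add_right, real_inner_smul_right, real_inner_smul_right]
  have h1 := mul_nonpos_of_nonneg_of_nonpos hs.le (hv y hy)
  have h2 := mul_nonpos_of_nonneg_of_nonpos ht (hu y hy)
  linarith

theorem volume_capCone_eq {u w : EucSp n} (hu : ‖u‖ = 1) (hw : ‖w‖ = 1) (c : ℝ) :
    volume (capCone u c ∩ ball 0 1) = volume (capCone w c ∩ ball 0 1) := by
  obtain ⟨T, rfl⟩ := exists_linearIsometryEquiv_apply_eq (x := u) (y := w) (by rw [hu, hw])
  rw [← T.measurePreserving.measure_preimage
    ((isClosed_capCone (T u) c).measurableSet.inter measurableSet_ball).nullMeasurableSet]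
  congr 1
  ext v
  simp [capCone]

theorem volume_inter_ball_ne_top (A : Set (EucSp n)) : volume (A ∩ ball 0 1) ≠ ⊤ :=
  ((measure_mono inter_subset_right).trans_lt measure_ball_lt_top).ne

theorem exists_mem_dualCone {W : Set (EucSp n)} (hW : IsCompact W) (hne : W.Nonempty)
    (v : EucSp n) : ∃ x ∈ W, v ∈ dualCone W x := by
  obtain ⟨x, hx, hmax⟩ := hW.exists_isMaxOn (f := fun y => inner ℝ y v) hne (by fun_prop)
  refine ⟨x, hx, fun y hy => ?_⟩
  rw [inner_sub_left]
  exact sub_nonpos.2 (hmax hy)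

theorem inner_eq_of_mem_dualCone {W : Set (EucSp n)} {x y v : EucSp n} (hx : x ∈ W) (hy : y ∈ W)
    (hvx : v ∈ dualCone W x) (hvy : v ∈ dualCone W y) : inner ℝ x v = inner ℝ y v := by
  have h1 := hvx y hy
  have h2 := hvy x hx
  rw [inner_sub_left] at h1 h2
  linarith

theorem volume_inner_eq_zero {z : EucSp n} (hz : z ≠ 0) :
    volume {v : EucSp n | inner ℝ z v = 0} = 0 := by
  have e : {v : EucSp n | inner ℝ z v = 0} = ((ℝ ∙ z)ᗮ : Submodule ℝ (EucSp n)) := by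
    ext v
    simp [Submodule.mem_orthogonal_singleton_iff_inner_right]
  rw [e]
  refine Measure.addHaar_submodule _ _ fun h => hz ?_
  have : z ∈ (ℝ ∙ z)ᗮ := by rw [h]; trivial
  simpa [Submodule.mem_orthogonal_singleton_iff_inner_right] using this

/-- The normal cones of the points of `W` tile the space. The correlation inequality holds in each
tile, with cap volumes that do not depend on the axis, so the tiles can be summed. -/
theorem volume_angleCone_finset {W : Finset (EucSp n)} (hne : W.Nonempty)
    {u : EucSp n → EucSp n} (hu : ∀ x ∈ W, ‖u x‖ = 1) (hmem : ∀ x ∈ W, u x ∈ dualCone W x)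
    {b c : ℝ} (hb : -1 ≤ b) (hbc : b ≤ c) (hc : c ≤ 1)
    (hW : ∀ x ∈ W, dualCone W x ⊆ capCone (u x) b) {e : EucSp n} (he : ‖e‖ = 1) :
    volume (ball (0 : EucSp n) 1) * volume (capCone e c ∩ ball 0 1) ≤
      volume (angleCone W u c ∩ ball 0 1) * volume (capCone e b ∩ ball 0 1) := by
  have hcover : ball (0 : EucSp n) 1 ⊆ ⋃ x ∈ W, dualCone W x ∩ ball 0 1 := by
    intro v hv
    obtain ⟨x, hx, hvx⟩ := exists_mem_dualCone W.finite_toSet.isCompact (by simpa using hne) v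
    exact mem_iUnion₂.2 ⟨x, hx, hvx, hv⟩
  have hunion : angleCone W u c ∩ ball 0 1 =
      ⋃ x ∈ W, dualCone W x ∩ capCone (u x) c ∩ ball 0 1 := by
    simp only [angleCone, iUnion₂_inter, Finset.mem_coe]
  have hsum : volume (angleCone W u c ∩ ball 0 1) =
      ∑ x ∈ W, volume (dualCone W x ∩ capCone (u x) c ∩ ball 0 1) := by
    rw [hunion]
    -- Two normal cones, at `x` and `y`, meet only inside the hyperplane orthogonal to `x - y`.
    refine measure_biUnion_finset₀ ?_ fun x _ => ?_
    · intro x hx y hy hxy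
      refine measure_mono_null ?_ (volume_inner_eq_zero (sub_ne_zero.2 hxy))
      rintro v ⟨hv, hv'⟩
      change inner ℝ (x - y) v = 0
      rw [inner_sub_left, inner_eq_of_mem_dualCone hx hy hv.1.1 hv'.1.1, sub_self]
    · exact (((isClosed_dualCone _ _).measurableSet.inter
        (isClosed_capCone _ _).measurableSet).inter measurableSet_ball).nullMeasurableSet
  rw [hsum, Finset.sum_mul]
  calc _ ≤ (∑ x ∈ W, volume (dualCone (W : Set (EucSp n)) x ∩ ball 0 1)) *
        volume (capCone e c ∩ ball 0 1) := by
        gcongr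
        exact (measure_mono hcover).trans (measure_biUnion_finset_le _ _)
    _ = ∑ x ∈ W, volume (dualCone (W : Set (EucSp n)) x ∩ ball 0 1) *
        volume (capCone e c ∩ ball 0 1) := Finset.sum_mul _ _ _
    _ ≤ _ := by
        refine Finset.sum_le_sum fun x hx => ?_
        rw [volume_capCone_eq he (hu x hx) c, volume_capCone_eq he (hu x hx) b]
        exact (isUpCone_dualCone (hmem x hx)).volume_mul_le (hu x hx)
          (isUpCone_capCone (hu x hx) (abs_le.2 ⟨hb.trans hbc, hc⟩))
          (isClosed_dualCone _ _).measurableSet (isClosed_capCone _ _).measurableSet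
          (isClosed_capCone _ _).measurableSet (isAxisymmetric_capCone _ _)
          (isAxisymmetric_capCone _ _) (hW x hx) (capCone_anti _ hbc)

/-- A normal cone at `x` of a set which has a point at depth `ε` below the hyperplane orthogonal to
`u` through `x` stays away from `-u`. -/
theorem dualCone_subset_capCone {W : Set (EucSp n)} {x y u : EucSp n} (hu : ‖u‖ = 1) (hy : y ∈ W)
    {ε R : ℝ} (hε : 0 < ε) (hR : 0 < R) (h : inner ℝ (y - x) u ≤ -ε) (hxy : ‖y - x‖ ≤ R) :
    dualCone W x ⊆ capCone u (-1 + ε ^ 2 / (2 * R ^ 2)) := by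
  intro v hv
  change _ * ‖v‖ ≤ _
  rcases eq_or_ne v 0 with rfl | hv0
  · simp
  have hpos : 0 < ‖v‖ := norm_pos_iff.2 hv0
  -- By Cauchy–Schwarz this keeps `v` at distance at least `ε‖v‖ / R` from `-‖v‖u`; expanding the
  -- squared distance gives the cosine bound.
  have h1 : inner ℝ (y - x) (v + ‖v‖ • u) ≤ -(ε * ‖v‖) := by
    rw [inner_add_right, real_inner_smul_right]
    nlinarith [hv y hy]
  have h2 : ε * ‖v‖ ≤ R * ‖v + ‖v‖ • u‖ := by
    have := (abs_le.1 (abs_real_inner_le_norm (y - x) (v + ‖v‖ • u))).1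
    nlinarith [mul_le_mul_of_nonneg_right hxy (norm_nonneg (v + ‖v‖ • u))]
  have h3 : ‖v + ‖v‖ • u‖ ^ 2 = 2 * ‖v‖ * (‖v‖ + inner ℝ v u) := by
    rw [norm_add_sq_real, real_inner_smul_right, norm_smul, hu, norm_norm]
    ring
  have h4 : (ε * ‖v‖) ^ 2 ≤ R ^ 2 * (2 * ‖v‖ * (‖v‖ + inner ℝ v u)) := by
    rw [← h3, ← mul_pow]
    exact pow_le_pow_left₀ (by positivity) h2 2
  have h5 : ε ^ 2 * ‖v‖ ≤ (2 * R ^ 2) * (‖v‖ + inner ℝ v u) := by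
    refine le_of_mul_le_mul_right ?_ hpos
    nlinarith
  have h6 : ε ^ 2 / (2 * R ^ 2) * ‖v‖ ≤ ‖v‖ + inner ℝ v u := by
    rw [div_mul_eq_mul_div, div_le_iff₀ (by positivity)]
    linarith
  linarith

/-- The inequality between the measures of the normals with large angle, for compact sets. The
last hypothesis is a condition on the normal cones of fine finite nets. -/
theorem volume_angleCone_compact {W : Set (EucSp n)} (hW : IsCompact W) (hne : W.Nonempty)
    {u : EucSp n → EucSp n} (hcont : ContinuousOn u W) (hu : ∀ x ∈ W, ‖u x‖ = 1)
    (hmem : ∀ x ∈ W, u x ∈ dualCone W x) {b c : ℝ} (hb : -1 ≤ b) (hbc : b ≤ c) (hc : c ≤ 1)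
    {e : EucSp n} (he : ‖e‖ = 1) {η : ℝ} (hη : 0 < η)
    (hnet : ∀ F : Set (EucSp n), F ⊆ W → (∀ y ∈ W, ∃ z ∈ F, dist y z < η) →
      ∀ x ∈ F, dualCone F x ⊆ capCone (u x) b) :
    volume (ball (0 : EucSp n) 1) * volume (capCone e c ∩ ball 0 1) ≤
      volume (angleCone W u c ∩ ball 0 1) * volume (capCone e b ∩ ball 0 1) := by
  -- Meshes below `η` activate `hnet`; meshes tending to zero make the nets exhaust `W`.
  have hr : ∀ k : ℕ, 0 < min η (1 / ((k : ℝ) + 1)) := fun k => lt_min hη (by positivity)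
  have hF : ∀ k : ℕ, ∃ F : Finset (EucSp n), (F : Set (EucSp n)) ⊆ W ∧
      ∀ y ∈ W, ∃ z ∈ F, dist y z < min η (1 / ((k : ℝ) + 1)) := by
    intro k
    obtain ⟨t, ht, htf, hcov⟩ := hW.finite_cover_balls (hr k)
    refine ⟨htf.toFinset, by simpa using ht, fun y hy => ?_⟩
    obtain ⟨z, hz, hyz⟩ := mem_iUnion₂.1 (hcov hy)
    exact ⟨z, by simpa using hz, hyz⟩
  choose F hFW hFnet using hF
  set G : ℕ → Set (EucSp n) := fun k => angleCone (F k) u c ∩ ball 0 1 with hG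
  have hGm : ∀ k, MeasurableSet (G k) := fun k =>
    (Finset.measurableSet_biUnion (F k) fun x _ => (isClosed_dualCone _ _).measurableSet.inter
      (isClosed_capCone _ _).measurableSet).inter measurableSet_ball
  have hGvol : ∀ k, volume (ball (0 : EucSp n) 1) * volume (capCone e c ∩ ball 0 1) ≤
      volume (G k) * volume (capCone e b ∩ ball 0 1) := by
    intro k
    have hFne : (F k).Nonempty := by
      obtain ⟨y, hy⟩ := hne
      obtain ⟨z, hz, -⟩ := hFnet k y hy
      exact ⟨z, hz⟩
    refine volume_angleCone_finset hFne (fun x hx => hu x (hFW k hx))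
      (fun x hx y hy => hmem x (hFW k hx) y (hFW k hy)) hb hbc hc (fun x hx => ?_) he
    refine hnet _ (hFW k) (fun y hy => ?_) x hx
    obtain ⟨z, hz, hyz⟩ := hFnet k y hy
    exact ⟨z, hz, hyz.trans_le (min_le_left _ _)⟩
  -- A direction in infinitely many `G k` has maximizers in the nets that subconverge in `W`; both
  -- conditions pass to the limit, by density of the nets and continuity of `u`.
  have hsub : ⋂ m, ⋃ k ≥ m, G k ⊆ angleCone W u c ∩ ball 0 1 := by
    intro v hv
    have hv' : ∀ m : ℕ, ∃ k ≥ m, v ∈ G k := fun m => by simpa using mem_iInter.1 hv m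
    choose k hk hvk using hv'
    refine ⟨?_, (hvk 0).2⟩
    have hx : ∀ m, ∃ x ∈ F (k m), v ∈ dualCone (F (k m)) x ∧ v ∈ capCone (u x) c := fun m => by
      obtain ⟨x, hx, h⟩ := mem_iUnion₂.1 (hvk m).1
      exact ⟨x, hx, h⟩
    choose x hxF hxd hxc using hx
    obtain ⟨a, haW, φ, hφ, hlim⟩ := hW.tendsto_subseq fun m => hFW _ (hxF m)
    refine mem_iUnion₂.2 ⟨a, haW, fun y hy => ?_, ?_⟩
    · choose z hzF hz using fun m => hFnet (k (φ m)) y hy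
      have hzlim : Tendsto z atTop (𝓝 y) := by
        rw [tendsto_iff_dist_tendsto_zero]
        refine squeeze_zero (fun _ => dist_nonneg) (fun m => ?_)
          tendsto_one_div_add_atTop_nhds_zero_nat
        rw [dist_comm]
        refine ((hz m).le.trans (min_le_right _ _)).trans ?_
        have : m ≤ k (φ m) := (hφ.id_le m).trans (hk _)
        gcongr
      exact le_of_tendsto ((hzlim.sub hlim).inner tendsto_const_nhds)
        (Eventually.of_forall fun m => hxd (φ m) _ (hzF m))
    · have hulim : Tendsto (fun m => u (x (φ m))) atTop (𝓝 (u a)) :=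
        (hcont a haW).tendsto.comp (tendsto_nhdsWithin_iff.2
          ⟨hlim, Eventually.of_forall fun m => hFW _ (hxF _)⟩)
      exact ge_of_tendsto ((tendsto_const_nhds (x := v)).inner hulim)
        (Eventually.of_forall fun m => show c * ‖v‖ ≤ _ from hxc (φ m))
  have hlim : Tendsto (fun m => volume (⋃ k ≥ m, G k)) atTop (𝓝 (volume (⋂ m, ⋃ k ≥ m, G k))) := by
    refine tendsto_measure_iInter_atTop (fun m => ?_) ?_ ⟨0, ?_⟩
    · exact (MeasurableSet.biUnion (to_countable _) fun k _ => hGm k).nullMeasurableSet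
    · exact fun m m' hmm => biUnion_subset_biUnion_left fun k hk => le_trans hmm hk
    · exact ((measure_mono (iUnion₂_subset fun k _ => inter_subset_right)).trans_lt
        measure_ball_lt_top).ne
  have h1 := ge_of_tendsto (ENNReal.Tendsto.mul_const hlim
    (Or.inr (volume_inter_ball_ne_top (capCone e b)))) (Eventually.of_forall fun m =>
      (hGvol m).trans (mul_le_mul_left (measure_mono (subset_iUnion₂ (s := fun k (_ : k ≥ m) => G k)
        m le_rfl)) _))
  exact h1.trans (mul_le_mul_left (measure_mono hsub) _)

/-- Almost every direction is maximized at a single point of a compact set. -/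
theorem volume_dualCone_inter_eq_zero {W : Set (EucSp n)} (hW : IsCompact W) :
    volume {v | ∃ x ∈ W, ∃ y ∈ W, x ≠ y ∧ v ∈ dualCone W x ∧ v ∈ dualCone W y} = 0 := by
  -- The support function is Lipschitz, so Rademacher's theorem applies; where it is differentiable,
  -- its gradient equals every maximizer.
  set h : EucSp n → ℝ := fun v => sSup ((fun y => inner ℝ y v) '' W) with hh
  have hbdd : ∀ v, BddAbove ((fun y => inner ℝ y v) '' W) := fun v =>
    hW.bddAbove_image (by fun_prop)
  have hle : ∀ x ∈ W, ∀ v, inner ℝ x v ≤ h v := fun x hx v =>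
    le_csSup (hbdd v) (mem_image_of_mem _ hx)
  obtain ⟨R, hR0, hR⟩ := hW.isBounded.exists_pos_norm_le
  rcases W.eq_empty_or_nonempty with rfl | hne
  · simp
  have hlip : LipschitzWith R.toNNReal h := by
    refine LipschitzWith.of_le_add_mul _ fun v w => ?_
    refine csSup_le (hne.image _) ?_
    rintro _ ⟨y, hy, rfl⟩
    rw [Real.coe_toNNReal _ hR0.le]
    change inner ℝ y v ≤ _
    have e : inner ℝ y v = inner ℝ y w + inner ℝ y (v - w) := by
      rw [inner_sub_right]; ring
    have h2 : inner ℝ y (v - w) ≤ R * dist v w := by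
      rw [dist_eq_norm]
      exact (real_inner_le_norm _ _).trans
        (mul_le_mul_of_nonneg_right (hR y hy) (norm_nonneg _))
    rw [e]
    linarith [hle y hy w]
  refine measure_mono_null ?_ hlip.ae_differentiableAt
  rintro v ⟨x, hx, y, hy, hxy, hvx, hvy⟩ (hd : DifferentiableAt ℝ h v)
  have key : ∀ z ∈ W, v ∈ dualCone W z → fderiv ℝ h v = innerSL ℝ z := by
    intro z hz hvz
    have heq : h v = inner ℝ z v := by
      refine le_antisymm (csSup_le (hne.image _) ?_) (hle z hz v)
      rintro _ ⟨y, hy, rfl⟩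
      have := hvz y hy
      rw [inner_sub_left] at this
      exact sub_nonpos.1 this
    have hmin : IsLocalMin (fun w => h w - innerSL ℝ z w) v := by
      refine Eventually.of_forall fun w => ?_
      simp only [innerSL_apply_apply, heq, sub_self]
      exact sub_nonneg.2 (hle z hz w)
    have h3 := hmin.fderiv_eq_zero
    rw [fderiv_fun_sub hd (innerSL ℝ z).differentiableAt, ContinuousLinearMap.fderiv] at h3
    exact sub_eq_zero.1 h3
  exact hxy (innerSL_inj.1 ((key x hx hvx).symm.trans (key y hy hvy)))

/-- At a zero of `g` the function `|g|` has a minimum, so its derivative could only be zero. But `g`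
grows along `u` at rate at least `1 - |c| > 0`, so `|g|` is not differentiable there, and
Rademacher's theorem applies. -/
theorem volume_capCone_boundary {u : EucSp n} (hu : ‖u‖ = 1) {c : ℝ} (hc : |c| < 1) :
    volume {v : EucSp n | c * ‖v‖ = inner ℝ v u} = 0 := by
  set g : EucSp n → ℝ := fun v => inner ℝ v u - c * ‖v‖ with hg
  have hlip : ∃ K, LipschitzWith K fun v => |g v| := by
    have h1 : LipschitzWith 1 fun v : EucSp n => inner ℝ v u := by
      refine LipschitzWith.of_dist_le_mul fun v w => ?_
      rw [Real.dist_eq, ← inner_sub_left, NNReal.coe_one, one_mul, dist_eq_norm]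
      simpa [hu] using abs_real_inner_le_norm (v - w) u
    have h2 : LipschitzWith ‖c‖₊ fun v : EucSp n => c * ‖v‖ := by
      refine LipschitzWith.of_dist_le_mul fun v w => ?_
      rw [Real.dist_eq, ← mul_sub, abs_mul, coe_nnnorm, Real.norm_eq_abs, dist_eq_norm]
      exact mul_le_mul_of_nonneg_left (abs_norm_sub_norm_le v w) (abs_nonneg c)
    exact ⟨_, lipschitzWith_one_norm.comp (h1.sub h2)⟩
  obtain ⟨K, hK⟩ := hlip
  refine measure_mono_null ?_ hK.ae_differentiableAt
  intro v (hv : c * ‖v‖ = _) (hd : DifferentiableAt ℝ (fun v => |g v|) v)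
  have hgv : g v = 0 := by simp [hg, hv]
  have hmin : IsLocalMin (fun v => |g v|) v :=
    Eventually.of_forall fun w => by simp [hgv]
  have hder := hd.hasFDerivAt
  rw [hmin.fderiv_eq_zero, hasFDerivAt_iff_isLittleO_nhds_zero] at hder
  have hpos : 0 < (1 - |c|) / 2 := by linarith
  have hev := hder.def hpos
  have hline : Tendsto (fun t : ℝ => t • u) (𝓝[>] 0) (𝓝 0) := by
    have : Continuous fun t : ℝ => t • u := by fun_prop
    simpa using (this.tendsto 0).mono_left nhdsWithin_le_nhds
  obtain ⟨t, ht, ht0⟩ := ((hline.eventually hev).and self_mem_nhdsWithin).exists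
  have ht0' : (0 : ℝ) < t := ht0
  simp only [hgv, abs_zero, sub_zero, zero_apply, norm_smul, hu, mul_one,
    Real.norm_eq_abs, abs_abs, abs_of_pos ht0'] at ht
  have h1 : |‖v + t • u‖ - ‖v‖| ≤ t := by
    have := abs_norm_sub_norm_le (v + t • u) v
    rwa [add_sub_cancel_left, norm_smul, hu, mul_one, Real.norm_eq_abs, abs_of_pos ht0'] at this
  have h2 : c * (‖v + t • u‖ - ‖v‖) ≤ |c| * t := by
    refine (le_abs_self _).trans ?_
    rw [abs_mul]
    exact mul_le_mul_of_nonneg_left h1 (abs_nonneg c)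
  have h3 : g (v + t • u) = t - c * (‖v + t • u‖ - ‖v‖) := by
    simp only [hg]
    rw [inner_add_left, real_inner_smul_left, real_inner_self_eq_norm_sq, hu, ← hv]
    ring
  have h4 := le_abs_self (g (v + t • u))
  nlinarith

/-- The angle condition only controls thresholds strictly above `cos θ₀`; this recovers the
threshold itself. -/
theorem tendsto_volume_capCone {e : EucSp n} (he : ‖e‖ = 1) {c : ℝ} (hc : |c| < 1) :
    Tendsto (fun k : ℕ => volume (capCone e (c + 1 / ((k : ℝ) + 1)) ∩ ball 0 1)) atTop
      (𝓝 (volume (capCone e c ∩ ball 0 1))) := by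
  have hmono : Monotone fun k : ℕ => capCone e (c + 1 / ((k : ℝ) + 1)) ∩ ball 0 1 := by
    intro k l hkl
    refine inter_subset_inter_left _ (capCone_anti e ?_)
    gcongr
  have h := tendsto_measure_iUnion_atTop (μ := volume) hmono
  have heq : volume (⋃ k : ℕ, capCone e (c + 1 / ((k : ℝ) + 1)) ∩ ball 0 1) =
      volume (capCone e c ∩ ball 0 1) := by
    refine le_antisymm (measure_mono (iUnion_subset fun k => inter_subset_inter_left _
      (capCone_anti e (by simp only [le_add_iff_nonneg_right]; positivity)))) ?_
    have hsub : capCone e c ∩ ball 0 1 ⊆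
        (⋃ k : ℕ, capCone e (c + 1 / ((k : ℝ) + 1)) ∩ ball 0 1) ∪
          {v | c * ‖v‖ = inner ℝ v e} := by
      rintro v ⟨hv, hvb⟩
      rcases (show c * ‖v‖ ≤ inner ℝ v e from hv).eq_or_lt with h0 | h0
      · exact Or.inr h0
      · left
        obtain ⟨k, hk⟩ := exists_nat_one_div_lt (sub_pos.2 h0)
        refine mem_iUnion.2 ⟨k, ?_, hvb⟩
        change (c + _) * ‖v‖ ≤ _
        have h1 : ‖v‖ < 1 := by simpa using hvb
        have h2 : (0 : ℝ) < 1 / ((k : ℝ) + 1) := by positivity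
        nlinarith
    refine (measure_mono hsub).trans ((measure_union_le _ _).trans ?_)
    rw [volume_capCone_boundary he hc, add_zero]
  rwa [heq] at h

theorem volume_capCone_pos {e : EucSp n} (he : ‖e‖ = 1) {c : ℝ} (hc : c < 1) :
    0 < volume (capCone e c ∩ ball 0 1) := by
  have hopen : IsOpen ({v : EucSp n | c * ‖v‖ < inner ℝ v e} ∩ ball 0 1) :=
    (isOpen_lt (by fun_prop) (by fun_prop)).inter isOpen_ball
  refine (hopen.measure_pos volume ⟨(1 / 2 : ℝ) • e, ?_, ?_⟩).trans_le
    (measure_mono (inter_subset_inter_left _ fun v (hv : c * ‖v‖ < _) => hv.le))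
  · change c * _ < _
    rw [real_inner_smul_left, real_inner_self_eq_norm_sq, norm_smul, he]
    norm_num
    linarith
  · rw [mem_ball_zero_iff, norm_smul, he]
    norm_num

theorem volume_capCone_lt {e : EucSp n} (he : ‖e‖ = 1) {c : ℝ} (hc : -1 < c) :
    volume (capCone e c ∩ ball 0 1) < volume (ball (0 : EucSp n) 1) := by
  have hopen : IsOpen ((capCone e c)ᶜ ∩ ball 0 1) :=
    (isClosed_capCone e c).isOpen_compl.inter isOpen_ball
  have hpos := hopen.measure_pos volume ⟨(-(1 / 2) : ℝ) • e, by
    change ¬ (c * _ ≤ _)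
    rw [real_inner_smul_left, real_inner_self_eq_norm_sq, norm_smul, he]
    norm_num
    linarith, by
    rw [mem_ball_zero_iff, norm_smul, he]
    norm_num⟩
  have hsplit := measure_inter_add_sdiff (μ := volume) (ball (0 : EucSp n) 1)
    (isClosed_capCone e c).measurableSet
  rw [← hsplit, inter_comm]
  refine ENNReal.lt_add_right (by rw [inter_comm]; exact volume_inter_ball_ne_top _) ?_
  rw [sdiff_eq, inter_comm]
  exact hpos.ne'

end Cones

/-! ### Contact set, free surface and total positive curvature -/

section Geometry

open Filter Topology Metric

variable {n : ℕ}

theorem IsC1ConvexSet.norm_outerUnitNormal {C : Set (EucSp n)} (hC : IsC1ConvexSet C)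
    {x : EucSp n} (hx : x ∈ frontier C) : ‖outerUnitNormal C x‖ = 1 := by
  obtain ⟨U, f, h⟩ := hC.exists_definingFunction x hx
  rw [outerUnitNormal_eq h hx, norm_smul, norm_inv, norm_norm,
    inv_mul_cancel₀ (norm_ne_zero_iff.2 (h.gradient_ne_zero x h.mem))]

/-- A defining function vanishes at `x` and is nonpositive along segments from `x` into `C`, so its
derivative in those directions is nonpositive. -/
theorem IsC1ConvexSet.outerUnitNormal_mem_dualCone {C : Set (EucSp n)} (hC : IsC1ConvexSet C)
    {x : EucSp n} (hx : x ∈ frontier C) : outerUnitNormal C x ∈ dualCone C x := by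
  obtain ⟨U, f, h⟩ := hC.exists_definingFunction x hx
  intro y hy
  rw [outerUnitNormal_eq h hx, real_inner_smul_right, real_inner_comm]
  refine mul_nonpos_of_nonneg_of_nonpos (by positivity) (le_of_tendsto (h.tendsto_slope hx _) ?_)
  have hline : Tendsto (fun t : ℝ => x + t • (y - x)) (𝓝[>] 0) (𝓝 x) := by
    have : Continuous (fun t : ℝ => x + t • (y - x)) := by fun_prop
    simpa using (this.tendsto 0).mono_left nhdsWithin_le_nhds
  have hone : ∀ᶠ t : ℝ in 𝓝[>] 0, t ≤ 1 :=
    ((eventually_lt_nhds one_pos).filter_mono nhdsWithin_le_nhds).mono fun t ht => ht.le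
  filter_upwards [hline (h.isOpen.mem_nhds h.mem), hone, self_mem_nhdsWithin] with t htU ht1 ht0
  have ht0' : (0 : ℝ) < t := ht0
  refine mul_nonpos_of_nonneg_of_nonpos (inv_pos.2 ht0').le ((h.mem_iff _ htU).1 ?_)
  exact hC.convex.add_smul_sub_mem (hC.isClosed.frontier_subset hx) hy ⟨ht0'.le, ht1⟩

theorem IsC1ConvexSet.continuousOn_outerUnitNormal {C : Set (EucSp n)} (hC : IsC1ConvexSet C) :
    ContinuousOn (outerUnitNormal C) (frontier C) := by
  intro x hx
  obtain ⟨U, f, h⟩ := hC.exists_definingFunction x hx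
  have hU : U ∈ 𝓝 x := h.isOpen.mem_nhds h.mem
  have hgrad : ContinuousAt (gradient f) x := by
    have h1 := (h.contDiffOn.continuousOn_fderiv_of_isOpen h.isOpen le_rfl).continuousAt hU
    exact (InnerProductSpace.toDual ℝ (EucSp n)).symm.continuous.continuousAt.comp h1
  have hcont : ContinuousAt (fun y => ‖gradient f y‖⁻¹ • gradient f y) x :=
    (hgrad.norm.inv₀ (norm_ne_zero_iff.2 (h.gradient_ne_zero x h.mem))).smul hgrad
  -- One defining function serves at all nearby boundary points, because the normal does not depend
  -- on the choice.
  refine hcont.continuousWithinAt.congr_of_eventuallyEq ?_ (outerUnitNormal_eq h hx)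
  filter_upwards [mem_nhdsWithin_of_mem_nhds hU, self_mem_nhdsWithin] with y hyU hy
  exact outerUnitNormal_eq { h with mem := hyU } hy

theorem contactSet_subset_frontier (C Ω : Set (EucSp n)) :
    contactSet C Ω ⊆ frontier C := by
  rintro x ⟨hx, hxC⟩
  refine ⟨subset_closure hxC, fun hint => ?_⟩
  obtain ⟨y, hy, -, hyC⟩ := mem_closure_iff.1 hx _ isOpen_interior hint
  exact hyC (interior_subset hy)

theorem IsAdmissiblePair.isCompact_freeSurface {C Ω : Set (EucSp n)} (h : IsAdmissiblePair C Ω) :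
    IsCompact (freeSurface C Ω) :=
  isCompact_of_isClosed_isBounded isClosed_closure
    (h.isBounded.closure.subset (sdiff_subset.trans frontier_subset_closure)).closure

theorem IsAdmissiblePair.isCompact_contactSet {C Ω : Set (EucSp n)} (h : IsAdmissiblePair C Ω) :
    IsCompact (contactSet C Ω) :=
  h.isCompact_freeSurface.inter_right h.isC1ConvexSet.isClosed

theorem IsAdmissiblePair.freeSurface_nonempty {C Ω : Set (EucSp n)} (h : IsAdmissiblePair C Ω) :
    (freeSurface C Ω).Nonempty := by
  refine Nonempty.closure ?_
  obtain ⟨p, hp⟩ := h.nonempty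
  obtain ⟨a, ha⟩ := h.isC1ConvexSet.interior_nonempty
  -- A functional separating a point of `Ω` from `C` attains its maximum over the closure of `Ω` off
  -- `C`, and not inside `Ω`, since it is not zero.
  obtain ⟨f, s, hfC, hfp⟩ := geometric_hahn_banach_closed_point h.isC1ConvexSet.convex
    h.isC1ConvexSet.isClosed (h.subset_compl hp)
  have hcomp : IsCompact (closure Ω) := h.isBounded.isCompact_closure
  obtain ⟨q, hq, hmax⟩ := hcomp.exists_isMaxOn (f := f) ⟨p, subset_closure hp⟩
    f.continuous.continuousOn
  refine ⟨q, ?_, fun hqC => ?_⟩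
  · rw [h.isOpen.frontier_eq]
    refine ⟨hq, fun hqΩ => ?_⟩
    have hloc : IsLocalMax f q := by
      filter_upwards [h.isOpen.mem_nhds hqΩ] with y hy using hmax (subset_closure hy)
    have h0 := hloc.fderiv_eq_zero
    rw [ContinuousLinearMap.fderiv] at h0
    have := hfC a (interior_subset ha)
    simp only [h0, zero_apply] at this hfp
    linarith
  · have h1 := hfC q hqC
    have h2 : f p ≤ f q := hmax (subset_closure hp)
    linarith

/-- The set of unit normals whose measure is the total positive curvature. -/
def freeNormals (C Ω : Set (EucSp n)) : Set (EucSp n) :=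
  ⋃ x ∈ freeSurface C Ω \ C, unitNormalCone (freeSurface C Ω) x

theorem freeNormals_subset_sphere (C Ω : Set (EucSp n)) : freeNormals C Ω ⊆ sphere 0 1 :=
  iUnion₂_subset fun _ _ _ hν => mem_sphere_zero_iff_norm.2 hν.1

/-- Stated for arbitrary `A`: this direction of the pushforward formula holds without measurability.
-/
theorem le_sphereMeasure {A G N : Set (EucSp n)} (hN : volume N = 0)
    (h : ∀ v ∈ G, v ≠ 0 → v ∉ N → ‖v‖⁻¹ • v ∈ A) : volume (G ∩ ball 0 1) ≤ sphereMeasure n A := by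
  have h1 := Measure.le_map_apply (μ := (volume : Measure (EucSp n)).restrict (ball 0 1))
    measurable_normalize.aemeasurable A
  refine le_trans ?_ h1
  rw [Measure.restrict_apply' measurableSet_ball]
  have hsub : G ∩ ball 0 1 ⊆ ((fun v : EucSp n => ‖v‖⁻¹ • v) ⁻¹' A ∩ ball 0 1) ∪ (N ∪ {0}) := by
    rintro v ⟨hv, hvb⟩
    by_cases h0 : v ∈ N ∪ {0}
    · exact Or.inr h0
    · rw [mem_union, not_or] at h0
      exact Or.inl ⟨h v hv h0.2 h0.1, hvb⟩
  refine (measure_mono hsub).trans ((measure_union_le _ _).trans ?_)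
  rw [measure_union_null hN (measure_singleton 0), add_zero]

theorem norm_normalize {v : EucSp n} (hv : v ≠ 0) : ‖‖v‖⁻¹ • v‖ = 1 := by
  rw [norm_smul, norm_inv, norm_norm, inv_mul_cancel₀ (norm_ne_zero_iff.2 hv)]

theorem isClosed_sphericalCap (θ : ℝ) : IsClosed (sphericalCap n θ) :=
  (isClosed_eq continuous_norm continuous_const).inter
    (isClosed_le (f := fun _ => Real.cos θ) (by fun_prop) (by fun_prop))

theorem sphereMeasure_sphericalCap (θ : ℝ) : sphereMeasure n (sphericalCap n θ) =
    volume (capCone (EuclideanSpace.single (Fin.last n) (1 : ℝ)) (Real.cos θ) ∩ ball 0 1) := by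
  refine le_antisymm ?_ (le_sphereMeasure (N := ∅) measure_empty fun v hv h0 _ => ?_)
  · rw [sphereMeasure_apply (isClosed_sphericalCap θ).measurableSet]
    refine measure_mono (inter_subset_inter_left _ ?_)
    rintro v ⟨h1, h2⟩
    have h0 : 0 < ‖v‖ := by
      rw [norm_pos_iff]
      rintro rfl
      simp at h1
    rw [real_inner_smul_left, ← div_eq_inv_mul, le_div_iff₀ h0] at h2
    exact h2
  · refine ⟨norm_normalize h0, ?_⟩
    rw [real_inner_smul_left, ← div_eq_inv_mul, le_div_iff₀ (norm_pos_iff.2 h0)]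
    exact hv

theorem sphereMeasure_sphere : sphereMeasure n (sphere 0 1) = volume (ball (0 : EucSp n) 1) := by
  have h1 := measure_add_measure_compl (μ := sphereMeasure n)
    (isClosed_sphere (x := (0 : EucSp n)) (ε := 1)).measurableSet
  rw [sphereMeasure_compl_sphere, add_zero, sphereMeasure_apply MeasurableSet.univ] at h1
  simpa using h1

theorem normalize_mem_unitNormalCone {X : Set (EucSp n)} {x v : EucSp n} (hv : v ∈ dualCone X x)
    (h0 : v ≠ 0) : ‖v‖⁻¹ • v ∈ unitNormalCone X x := by
  refine ⟨norm_normalize h0, fun y hy => ?_⟩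
  rw [real_inner_smul_right]
  exact mul_nonpos_of_nonneg_of_nonpos (by positivity) (hv y hy)

theorem IsAdmissiblePair.freeNormals_eq_sphere {C Ω : Set (EucSp n)} (h : IsAdmissiblePair C Ω)
    (hW : contactSet C Ω = ∅) : freeNormals C Ω = sphere 0 1 := by
  refine (freeNormals_subset_sphere C Ω).antisymm fun v hv => ?_
  have hv1 : ‖v‖ = 1 := by simpa using hv
  obtain ⟨y, hy, hyv⟩ := exists_mem_dualCone h.isCompact_freeSurface h.freeSurface_nonempty v
  refine mem_iUnion₂.2 ⟨y, ⟨hy, fun hyC => ?_⟩, hv1, hyv⟩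
  have : y ∈ contactSet C Ω := ⟨hy, hyC⟩
  rw [hW] at this
  exact this

/-- Almost every direction making a small angle with the normal of `C` at the contact point is a
normal of the free surface outside `C`. -/
theorem IsAdmissiblePair.volume_angleCone_le {C Ω : Set (EucSp n)} (h : IsAdmissiblePair C Ω)
    {c₀ c : ℝ} (hang : ContactAngleBound C Ω c₀) (hc : c₀ < c) :
    volume (angleCone (contactSet C Ω) (outerUnitNormal C) c ∩ ball 0 1) ≤
      sphereMeasure n (freeNormals C Ω) := by
  refine le_sphereMeasure (volume_dualCone_inter_eq_zero h.isCompact_contactSet) ?_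
  intro v hv h0 hdup
  obtain ⟨x, hx, hvx, hcap⟩ := mem_iUnion₂.1 hv
  obtain ⟨y, hy, hyv⟩ := exists_mem_dualCone h.isCompact_freeSurface h.freeSurface_nonempty v
  have hmem := normalize_mem_unitNormalCone hyv h0
  -- If `y` were in `C`, it would maximize `v` over the contact set too, so `y = x` by uniqueness,
  -- and the cosine would be both at most `c₀` and at least `c`.
  by_cases hyC : y ∈ C
  · exfalso
    have hxy : x = y := by
      by_contra hne
      exact hdup ⟨x, hx, y, ⟨hy, hyC⟩, hne, hvx, fun z hz => hyv z hz.1⟩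
    subst hxy
    have h1 := hang x hx _ hmem
    have hpos : 0 < ‖v‖ := norm_pos_iff.2 h0
    rw [real_inner_smul_left, ← div_eq_inv_mul, div_le_iff₀ hpos] at h1
    have h2 : c * ‖v‖ ≤ _ := hcap
    nlinarith
  · exact mem_iUnion₂.2 ⟨y, ⟨hy, hyC⟩, hmem⟩

/-- The lower bound for the measure of the normals of the free surface, under a condition on the
normal cones of fine nets of the contact set. -/
theorem IsAdmissiblePair.measure_freeNormals_ge {C Ω : Set (EucSp n)} (h : IsAdmissiblePair C Ω)
    (hne : (contactSet C Ω).Nonempty) {c₀ b c : ℝ} (hang : ContactAngleBound C Ω c₀)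
    (hb : -1 ≤ b) (hbc : b ≤ c) (hc₀ : c₀ < c) (hc : c ≤ 1) {e : EucSp n} (he : ‖e‖ = 1) {η : ℝ}
    (hη : 0 < η)
    (hnet : ∀ F ⊆ contactSet C Ω, (∀ y ∈ contactSet C Ω, ∃ z ∈ F, dist y z < η) →
      ∀ x ∈ F, dualCone F x ⊆ capCone (outerUnitNormal C x) b) :
    volume (ball (0 : EucSp n) 1) * volume (capCone e c ∩ ball 0 1) ≤
      sphereMeasure n (freeNormals C Ω) * volume (capCone e b ∩ ball 0 1) := by
  have hfr := contactSet_subset_frontier C Ω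
  refine (volume_angleCone_compact h.isCompact_contactSet hne
    (h.isC1ConvexSet.continuousOn_outerUnitNormal.mono hfr)
    (fun x hx => h.isC1ConvexSet.norm_outerUnitNormal (hfr hx))
    (fun x hx y hy => h.isC1ConvexSet.outerUnitNormal_mem_dualCone (hfr hx) y hy.2)
    hb hbc hc he hη hnet).trans ?_
  exact mul_le_mul_left (h.volume_angleCone_le hang hc₀) _

theorem norm_lastVector : ‖(EuclideanSpace.single (Fin.last n) (1 : ℝ) : EucSp n)‖ = 1 := by
  simp

theorem eventually_add_one_div_le {c : ℝ} (hc : c < 1) :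
    ∀ᶠ k : ℕ in atTop, c + 1 / ((k : ℝ) + 1) ≤ 1 := by
  have h := (tendsto_one_div_add_atTop_nhds_zero_nat (𝕜 := ℝ)).const_add c
  rw [add_zero] at h
  exact (h.eventually_lt_const hc).mono fun k hk => hk.le

theorem IsAdmissiblePair.volume_capCone_le {C Ω : Set (EucSp n)} (h : IsAdmissiblePair C Ω)
    {c₀ : ℝ} (hc₀ : |c₀| < 1) (hang : ContactAngleBound C Ω c₀) {e : EucSp n} (he : ‖e‖ = 1) :
    volume (capCone e c₀ ∩ ball 0 1) ≤ sphereMeasure n (freeNormals C Ω) := by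
  rcases (contactSet C Ω).eq_empty_or_nonempty with hW | hne
  · rw [h.freeNormals_eq_sphere hW, sphereMeasure_sphere]
    exact measure_mono inter_subset_right
  have hc := abs_lt.1 hc₀
  refine le_of_tendsto (tendsto_volume_capCone he hc₀) ?_
  filter_upwards [eventually_add_one_div_le hc.2] with k hk
  have hpos : (0 : ℝ) < 1 / ((k : ℝ) + 1) := by positivity
  have hfr := contactSet_subset_frontier C Ω
  -- For `b = -1` the comparison cone is the whole space: the net condition is void and the ball
  -- volume cancels.
  have h1 := h.measure_freeNormals_ge hne hang le_rfl (b := -1) (by linarith) (by linarith) hk he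
    one_pos fun F hF _ x hx => by
      rw [capCone_neg_one (h.isC1ConvexSet.norm_outerUnitNormal (hfr (hF hx)))]
      exact subset_univ _
  rw [capCone_neg_one he, univ_inter, mul_comm] at h1
  exact (ENNReal.mul_le_mul_iff_left (measure_ball_pos volume _ one_pos).ne'
    measure_ball_lt_top.ne).1 h1

theorem setWidth_le_of_liesInSlab {X : Set (EucSp n)} (hne : X.Nonempty) {ν : EucSp n}
    (hν : ‖ν‖ = 1) {ε : ℝ} (hX : IsCompact X) (h : LiesInSlab X ν ε) : setWidth X ≤ ε := by
  obtain ⟨t, ht⟩ := h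
  have hbelow : BddBelow (range fun ν : sphere (0 : EucSp n) 1 =>
      sSup ((fun x => inner ℝ x (ν : EucSp n)) '' X) -
        sInf ((fun x => inner ℝ x (ν : EucSp n)) '' X)) := by
    refine ⟨0, ?_⟩
    rintro _ ⟨μ, rfl⟩
    have hcomp : IsCompact ((fun x => inner ℝ x (μ : EucSp n)) '' X) := hX.image (by fun_prop)
    exact sub_nonneg.2 (csInf_le_csSup (hne.image _) hcomp.bddBelow hcomp.bddAbove)
  refine (ciInf_le hbelow ⟨ν, by simpa using hν⟩).trans ?_
  have h1 : sSup ((fun x => inner ℝ x ν) '' X) ≤ t + ε :=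
    csSup_le (hne.image _) (by rintro _ ⟨x, hx, rfl⟩; exact (ht x hx).2)
  have h2 : t ≤ sInf ((fun x => inner ℝ x ν) '' X) :=
    le_csInf (hne.image _) (by rintro _ ⟨x, hx, rfl⟩; exact (ht x hx).1)
  change sSup ((fun x => inner ℝ x ν) '' X) - sInf ((fun x => inner ℝ x ν) '' X) ≤ ε
  linarith

/-- If the contact set lies in no slab of width `ε` orthogonal to a normal at one of its points,
the normal cones of its fine nets stay away from the inner normals. -/
theorem IsAdmissiblePair.dualCone_net_subset {C Ω : Set (EucSp n)} (h : IsAdmissiblePair C Ω)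
    {r ε : ℝ} (hr : 0 < r) (hε : 0 < ε) (hWr : contactSet C Ω ⊆ ball 0 r)
    (hslab : ∀ x ∈ contactSet C Ω, ¬ LiesInSlab (contactSet C Ω) (outerUnitNormal C x) ε)
    {F : Set (EucSp n)} (hF : F ⊆ contactSet C Ω)
    (hnet : ∀ y ∈ contactSet C Ω, ∃ z ∈ F, dist y z < ε / 2) {x : EucSp n} (hx : x ∈ F) :
    dualCone F x ⊆ capCone (outerUnitNormal C x) (-1 + (ε / 2) ^ 2 / (2 * (2 * r) ^ 2)) := by
  have hfr := hF.trans (contactSet_subset_frontier C Ω)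
  set u := outerUnitNormal C x with hu
  have hu1 : ‖u‖ = 1 := h.isC1ConvexSet.norm_outerUnitNormal (hfr hx)
  -- `C` lies below its tangent hyperplane at `x`, so the slab can only fail on the lower side.
  obtain ⟨y, hy, hyx⟩ : ∃ y ∈ contactSet C Ω, inner ℝ (y - x) u < -ε := by
    by_contra! hcon
    refine hslab x (hF hx) ⟨inner ℝ x u - ε, fun y hy => ?_⟩
    have h1 := hcon y hy
    have h2 := h.isC1ConvexSet.outerUnitNormal_mem_dualCone (hfr hx) y hy.2
    rw [← hu] at h2
    rw [inner_sub_left] at h1 h2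
    constructor <;> linarith
  obtain ⟨z, hz, hyz⟩ := hnet y hy
  -- Replacing `y` by a net point costs at most `ε / 2` of depth; two points of the ball are less
  -- than `2 * r` apart.
  refine dualCone_subset_capCone hu1 hz (by positivity) (by positivity) ?_ ?_
  · have h1 : inner ℝ (z - x) u = inner ℝ (y - x) u + inner ℝ (z - y) u := by
      rw [← inner_add_left]
      congr 1
      abel
    have h2 : inner ℝ (z - y) u ≤ ‖z - y‖ := by
      simpa [hu1] using real_inner_le_norm (z - y) u
    rw [dist_comm, dist_eq_norm] at hyz
    linarith
  · have h1 : ‖z‖ < r := by simpa using hWr (hF hz)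
    have h2 : ‖x‖ < r := by simpa using hWr (hF hx)
    linarith [norm_sub_le z x]

/-! ### Stability and the equality case -/

/-- The quantitative stability statement. -/
theorem exists_stability_constant (n : ℕ) {θ : ℝ} (hθ : θ ∈ Ioo 0 Real.pi) {r ε : ℝ} (hr : 0 < r)
    (hε : 0 < ε) : ∃ δ : ℝ, 0 < δ ∧ ∀ C Ω : Set (EucSp n), IsAdmissiblePair C Ω →
      contactSet C Ω ⊆ ball 0 r → ContactAngleBound C Ω (Real.cos θ + δ) →
      totalPositiveCurvature C Ω ≤ hausdorffSurface n (sphericalCap n θ) + ENNReal.ofReal δ →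
      (contactSet C Ω).Nonempty ∧
        ∃ x ∈ contactSet C Ω, LiesInSlab (contactSet C Ω) (outerUnitNormal C x) ε := by
  obtain ⟨κ, hκ0, hκtop, hκ⟩ := exists_hausdorffSurface_eq_smul n
  set e : EucSp n := EuclideanSpace.single (Fin.last n) (1 : ℝ)
  have he : ‖e‖ = 1 := norm_lastVector
  set c₀ := Real.cos θ with hc₀
  have hc₀1 : c₀ < 1 := by
    rw [hc₀, ← Real.cos_zero]
    exact Real.cos_lt_cos_of_nonneg_of_le_pi le_rfl hθ.2.le hθ.1
  have hc₀2 : -1 < c₀ := by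
    rw [hc₀, ← Real.cos_pi]
    exact Real.cos_lt_cos_of_nonneg_of_le_pi hθ.1.le le_rfl hθ.2
  -- The second entry is the gap around `-u` forced by the failure of the slabs; the minimum with
  -- `c₀` ensures `b ≤ c`.
  set b := min c₀ (-1 + (ε / 2) ^ 2 / (2 * (2 * r) ^ 2)) with hbdef
  have hb : -1 < b := lt_min hc₀2 (by simp only [lt_add_iff_pos_right]; positivity)
  set V := volume (ball (0 : EucSp n) 1)
  have hVtop : V ≠ ⊤ := measure_ball_lt_top.ne
  set X := volume (capCone e c₀ ∩ ball 0 1)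
  have hXtop : X ≠ ⊤ := volume_inter_ball_ne_top _
  set Vb := volume (capCone e b ∩ ball 0 1)
  have hVbtop : Vb ≠ ⊤ := volume_inter_ball_ne_top _
  have hlim := ENNReal.Tendsto.const_mul (tendsto_volume_capCone he (abs_lt.2 ⟨hc₀2, hc₀1⟩))
    (Or.inr hVtop)
  have hlt : Vb * X < V * X :=
    ENNReal.mul_lt_mul_left (volume_capCone_pos he hc₀1).ne' hXtop (volume_capCone_lt he hb)
  -- The gain from `V` to `Vb` is strict, so it survives raising the threshold slightly from `c₀` to
  -- `c`.
  obtain ⟨k, hk, hk1⟩ := ((hlim.eventually_const_lt hlt).and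
    (eventually_add_one_div_le hc₀1)).exists
  set c := c₀ + 1 / ((k : ℝ) + 1)
  have hc : c₀ < c := lt_add_of_pos_right _ (by positivity)
  have hcap : hausdorffSurface n (sphericalCap n θ) = κ * X := by
    rw [hκ _ fun v hv => mem_sphere_zero_iff_norm.2 hv.1, sphereMeasure_sphericalCap]
  -- In order: `δ` is positive, the perturbed angle bound stays below `c`, an empty contact set is
  -- ruled out, and the improved lower bound is violated. None of this involves `C` or `Ω`.
  have hδ : ∀ᶠ δ : ℝ in 𝓝[>] 0, 0 < δ ∧ c₀ + δ < c ∧ κ * X + ENNReal.ofReal δ < κ * V ∧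
      Vb * (κ * X + ENNReal.ofReal δ) < κ * (V * volume (capCone e c ∩ ball 0 1)) := by
    have h1 : Tendsto (fun δ : ℝ => c₀ + δ) (𝓝[>] 0) (𝓝 c₀) := by
      have : Continuous fun δ : ℝ => c₀ + δ := by fun_prop
      simpa using (this.tendsto 0).mono_left nhdsWithin_le_nhds
    have h2 : Tendsto (fun δ : ℝ => κ * X + ENNReal.ofReal δ) (𝓝[>] 0) (𝓝 (κ * X)) := by
      have : Continuous fun δ : ℝ => κ * X + ENNReal.ofReal δ :=
        continuous_const.add ENNReal.continuous_ofReal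
      simpa using (this.tendsto 0).mono_left nhdsWithin_le_nhds
    have h3 := ENNReal.Tendsto.const_mul h2 (Or.inr hVbtop)
    have h4 : κ * X < κ * V :=
      ENNReal.mul_lt_mul_right hκ0 hκtop (volume_capCone_lt he hc₀2)
    have h5 : Vb * (κ * X) < κ * (V * volume (capCone e c ∩ ball 0 1)) := by
      rw [mul_left_comm]
      exact ENNReal.mul_lt_mul_right hκ0 hκtop hk
    filter_upwards [self_mem_nhdsWithin, h1.eventually_lt_const hc, h2.eventually_lt_const h4,
      h3.eventually_lt_const h5] with δ hδ0 hδ1 hδ2 hδ3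
    exact ⟨hδ0, hδ1, hδ2, hδ3⟩
  obtain ⟨δ, hδ0, hδ1, hδ2, hδ3⟩ := hδ.exists
  refine ⟨δ, hδ0, fun C Ω h hWr hang hK => ?_⟩
  have hKeq : totalPositiveCurvature C Ω = κ * sphereMeasure n (freeNormals C Ω) :=
    hκ _ (freeNormals_subset_sphere C Ω)
  rw [hKeq, hcap] at hK
  have hne : (contactSet C Ω).Nonempty := by
    rw [nonempty_iff_ne_empty]
    intro hW
    rw [h.freeNormals_eq_sphere hW, sphereMeasure_sphere] at hK
    exact absurd hK (not_le.2 hδ2)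
  refine ⟨hne, ?_⟩
  by_contra! hslab
  have h1 := h.measure_freeNormals_ge hne hang hb.le ((min_le_left _ _).trans hc.le) hδ1 hk1 he
    (half_pos hε) fun F hF hnet x hx =>
      (h.dualCone_net_subset hr hε hWr hslab hF hnet hx).trans (capCone_anti _ (min_le_right _ _))
  have h2 : κ * (V * volume (capCone e c ∩ ball 0 1)) ≤ Vb * (κ * X + ENNReal.ofReal δ) := by
    calc _ ≤ κ * (sphereMeasure n (freeNormals C Ω) * Vb) := by gcongr
      _ = Vb * (κ * sphereMeasure n (freeNormals C Ω)) := by ring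
      _ ≤ _ := by gcongr
  exact absurd h2 (not_le.2 hδ3)

/-- The base points subconverge to some `a`, and their normals to the normal at `a`; in the limit
the slabs collapse to the tangent hyperplane there. -/
theorem IsAdmissiblePair.liesOnSupportHyperplane {C Ω : Set (EucSp n)} (h : IsAdmissiblePair C Ω)
    (hslab : ∀ k : ℕ, ∃ x ∈ contactSet C Ω,
      LiesInSlab (contactSet C Ω) (outerUnitNormal C x) (1 / ((k : ℝ) + 1))) :
    LiesOnSupportHyperplane (contactSet C Ω) C := by
  have hfr := contactSet_subset_frontier C Ω
  choose x hx t ht using hslab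
  obtain ⟨a, ha, φ, hφ, hlim⟩ := h.isCompact_contactSet.tendsto_subseq hx
  have hulim : Tendsto (fun m => outerUnitNormal C (x (φ m))) atTop (𝓝 (outerUnitNormal C a)) :=
    ((h.isC1ConvexSet.continuousOn_outerUnitNormal.mono hfr) a ha).tendsto.comp
      (tendsto_nhdsWithin_iff.2 ⟨hlim, Eventually.of_forall fun m => hx _⟩)
  refine ⟨a, ha.2, outerUnitNormal C a, ⟨h.isC1ConvexSet.norm_outerUnitNormal (hfr ha),
    h.isC1ConvexSet.outerUnitNormal_mem_dualCone (hfr ha)⟩, fun y hy => ?_⟩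
  have h1 : Tendsto (fun m => |inner ℝ (y - a) (outerUnitNormal C (x (φ m)))|) atTop
      (𝓝 |inner ℝ (y - a) (outerUnitNormal C a)|) :=
    ((tendsto_const_nhds (x := y - a)).inner hulim).abs
  have h2 := (tendsto_one_div_add_atTop_nhds_zero_nat (𝕜 := ℝ)).comp hφ.tendsto_atTop
  have h3 := le_of_tendsto_of_tendsto' h1 h2 fun m => by
    have h4 := ht (φ m) y hy
    have h5 := ht (φ m) a ha
    simp only [Function.comp_apply]
    rw [inner_sub_left, abs_le]
    constructor <;> linarith
  exact abs_eq_zero.1 (le_antisymm h3 (abs_nonneg _))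

end Geometry

theorem theorem1p3 (n : ℕ) (θ₀ : ℝ) (hθ₀ : θ₀ ∈ Set.Ioo 0 Real.pi) :
    -- the lower bound on the total positive curvature
    (∀ C Ω : Set (EucSp n), IsAdmissiblePair C Ω → ContactAngleBound C Ω (Real.cos θ₀) →
      hausdorffSurface n (sphericalCap n θ₀) ≤ totalPositiveCurvature C Ω) ∧
    -- stability, with `δ` independent of `C` and `Ω`
    (∀ r : ℝ, 0 < r → ∀ ε : ℝ, 0 < ε → ∃ δ : ℝ, 0 < δ ∧
      ∀ C Ω : Set (EucSp n), IsAdmissiblePair C Ω → contactSet C Ω ⊆ Metric.ball 0 r →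
        ContactAngleBound C Ω (Real.cos θ₀ + δ) →
        totalPositiveCurvature C Ω ≤
          hausdorffSurface n (sphericalCap n θ₀) + ENNReal.ofReal δ →
        (contactSet C Ω).Nonempty ∧
        setWidth (contactSet C Ω) ≤ ε ∧
        ∃ x ∈ contactSet C Ω, LiesInSlab (contactSet C Ω) (outerUnitNormal C x) ε) ∧
    -- the equality case
    (∀ C Ω : Set (EucSp n), IsAdmissiblePair C Ω → ContactAngleBound C Ω (Real.cos θ₀) →
      totalPositiveCurvature C Ω = hausdorffSurface n (sphericalCap n θ₀) →
      (contactSet C Ω).Nonempty ∧ LiesOnSupportHyperplane (contactSet C Ω) C) := by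
  have hcos : |Real.cos θ₀| < 1 := by
    rw [abs_lt, ← Real.cos_pi, ← Real.cos_zero]
    exact ⟨Real.cos_lt_cos_of_nonneg_of_le_pi hθ₀.1.le le_rfl hθ₀.2,
      Real.cos_lt_cos_of_nonneg_of_le_pi le_rfl hθ₀.2.le hθ₀.1⟩
  refine ⟨fun C Ω h hang => ?_, fun r hr ε hε => ?_, fun C Ω h hang heq => ?_⟩
  · obtain ⟨κ, -, -, hκ⟩ := exists_hausdorffSurface_eq_smul n
    have hK : totalPositiveCurvature C Ω = κ * sphereMeasure n (freeNormals C Ω) :=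
      hκ _ (freeNormals_subset_sphere C Ω)
    rw [hK, hκ _ fun v hv => mem_sphere_zero_iff_norm.2 hv.1, sphereMeasure_sphericalCap]
    exact mul_le_mul_right (h.volume_capCone_le hcos hang norm_lastVector) κ
  · obtain ⟨δ, hδ, H⟩ := exists_stability_constant n hθ₀ hr hε
    refine ⟨δ, hδ, fun C Ω h hWr hang hK => ?_⟩
    obtain ⟨hne, x, hx, hslab⟩ := H C Ω h hWr hang hK
    have hnorm := h.isC1ConvexSet.norm_outerUnitNormal (contactSet_subset_frontier C Ω hx)
    exact ⟨hne, setWidth_le_of_liesInSlab hne hnorm h.isCompact_contactSet hslab, x, hx, hslab⟩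
  -- Here `r` may depend on the pair: stability is applied to a single pair, for every `ε`.
  · obtain ⟨r, hr, hWr⟩ := h.isCompact_contactSet.isBounded.subset_ball_lt 0 0
    have H : ∀ ε : ℝ, 0 < ε → (contactSet C Ω).Nonempty ∧
        ∃ x ∈ contactSet C Ω, LiesInSlab (contactSet C Ω) (outerUnitNormal C x) ε := by
      intro ε hε
      obtain ⟨δ, hδ, H⟩ := exists_stability_constant n hθ₀ hr hε
      exact H C Ω h hWr (fun x hx ν hν => (hang x hx ν hν).trans (by linarith))
        (heq.le.trans le_self_add)
    exact ⟨(H 1 one_pos).1, h.liesOnSupportHyperplane fun k => (H _ (by positivity)).2⟩
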